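/- **Setting.** Let $N$ be a smooth $\mathfrak n$-manifold. *Hypersurface data* $\{N,\gamma,\ell,\ell^{(2)},Y\}$ consist of smooth symmetric $2$-covariant tensors $\gamma,Y$, a covector field $\ell$ and a function $\ell^{(2)}$ such that $\mathcal A((W,a),(Z,b))=\gamma(W,Z)+a\,\ell(Z)+b\,\ell(W)+ab\,\ell^{(2)}$ is non-degenerate on $T_pN\times\mathbb R$ for every $p$. They define a symmetric $P^{ab}$, a vector field $n^a$ and a scalar $n^{(2)}$ by $\gamma_{ab}n^b+n^{(2)}\ell_a=0$, $\ell_an^a+n^{(2)}\ell^{(2)}=1$, $P^{ab}\ell_b+\ell^{(2)}n^a=0$, $P^{ab}\gamma_{bc}+n^a\ell_c=\delta^a_c$; the data are *null* if $n^{(2)}=0$. Put $F=\frac12 d\ell$, $s=F(n,\cdot)$, $U=\frac12\pounds_n\gamma+\ell\otimes_s dn^{(2)}$, and let $\overset{\circ}{\nabla}$ be the torsion-free connection with $\overset{\circ}{\nabla}_a\gamma_{bc}=-\ell_bU_{ac}-\ell_cU_{ab}$ and $\overset{\circ}{\nabla}_a\ell_b=F_{ab}-\ell^{(2)}U_{ab}$.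 The data are *embedded* in a Lorentzian manifold $(M,g)$ of dimension $\mathfrak n+1$ with embedding $\iota:N\to M$ and rigging $L$ (a smooth vector field along $\iota$, everywhere transversal to $\iota(N)$) if $\gamma=\iota^*g$, $\ell=\iota^*(g(L,\cdot))$, $\ell^{(2)}=\iota^*(g(L,L))$ and $Y=\frac12\iota^*(\pounds_Lg)$. **Hypotheses.** Let $(M^\pm,g^\pm)$ be Lorentzian manifolds with boundary, of dimension $\mathfrak n+1$. Let $\mathcal D=\{N,\gamma,\ell,\ell^{(2)},Y^-\}$ and $\widehat{\mathcal D}=\{N,\hat\gamma,\hat\ell,\hat\ell^{(2)},\hat Y^+\}$ be null hypersurface data embedded in $(M^-,g^-)$, $(M^+,g^+)$ with embeddings $\iota^\pm$, $\iota^\pm(N)=\partial M^\pm$, and riggings $L^\pm$; thus $Y^-=\frac12(\iota^-)^*(\pounds_{L^-}g^-)$ and $\hat Y^+=\frac12(\iota^+)^*(\pounds_{L^+}g^+)$. Let $\epsilon^\pm=+1$ if $L^\pm$ points outwards and $\epsilon^\pm=-1$ if it points inwards. Let $\varphi:N\to N$ be a diffeomorphism for which the matching conditions hold: there are a nowhere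 zero $\bar z\in C^\infty(N)$ and a smooth vector field $V$ with $$\varphi^*\hat\gamma=\gamma,\quad \bar z\big(\varphi^*\hat\ell+(\varphi^*\hat\gamma)(V,\cdot)\big)=\ell,\quad \bar z^2\big(\varphi^*\hat\ell^{(2)}+2(\varphi^*\hat\ell)(V)+(\varphi^*\hat\gamma)(V,V)\big)=\ell^{(2)},\quad \operatorname{sign}\bar z=-\operatorname{sign}\epsilon^+\operatorname{sign}\epsilon^-.$$ Put $\epsilon=\epsilon^-$, $\vartheta=\varphi^*\hat\ell$, $z=1/\vartheta(n)$ and $Q=P(\vartheta,\vartheta)-\varphi^*\hat\ell^{(2)}$. Let $\xi^+$ be the vector field along $\iota^+$ given by $\xi^+=z'\big(L^+-\iota^+_*\varphi_*(P(\vartheta,\cdot))+\mu\,\iota^+_*\varphi_*n\big)$ with $\varphi^*z'=z$ and $\varphi^*\mu=\frac{Q}{2\vartheta(n)}$ ($z',\mu$ being regarded as functions on $N$ through $\iota^+$). Let $Y^+=\frac12\varphi^*\big((\iota^+)^*(\pounds_{\xi^+}g^+)\big)$ and $[Y]=Y^+-Y^-$. **Conclusion.** The function $\vartheta(n)$ vanishes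 nowhere, $z$ is smooth, and $$[Y]_{ab}=z\Big((\varphi^*\hat Y^+)_{ab}+\tfrac z2\,Q\,U_{ab}-\overset{\circ}{\nabla}_{(a}\vartheta_{b)}\Big)-Y^-_{ab}.$$ Moreover, for every basis $\{n,e_A\}$, $A=2,\dots,\mathfrak n$, with dual basis $\{\nu,\theta^A\}$ (at any point, hence for any local or global frame), the matrix $\mathfrak h_{AB}=\gamma(e_A,e_B)$ is invertible, with inverse $\mathfrak h^{AB}$ say, and the following hold. 1. The components of $[Y]$ are $$[Y](e_A,e_B)=(z\varphi^*\hat Y^+-Y^-)(e_A,e_B)+\tfrac{z^2}2Q\,U(e_A,e_B)-z\,e_A^ae_B^b\overset{\circ}{\nabla}_{(a}\vartheta_{b)},$$ $$[Y](n,e_A)=(z\varphi^*\hat Y^+-Y^-)(n,e_A)-\tfrac z2(\pounds_n\vartheta)(e_A)+\tfrac{e_A(z)}{2z}+s(e_A)+zP(\vartheta,U(e_A,\cdot)),$$ $$[Y](n,n)=(z\varphi^*\hat Y^+-Y^-)(n,n)+\tfrac{n(z)}z.$$ 2. The energy-momentum tensor of the shell, $$\tau^{df}=\epsilon\Big((P^{af}n^d+P^{ad}n^f)n^b-(n^{(2)}P^{af}P^{bd}+P^{df}n^an^b)+P^{ab}(n^{(2)}P^{df}-n^dn^f)\Big)[Y]_{ab},$$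 satisfies $\tau(\nu,\nu)=-\epsilon\,\mathfrak h^{AB}[Y](e_A,e_B)$, $\tau(\nu,\theta^A)=\epsilon\,\mathfrak h^{AB}[Y](n,e_B)$ and $\tau(\theta^A,\theta^B)=-\epsilon\,\mathfrak h^{AB}[Y](n,n)$. 3. Let $\rho=-\epsilon\,\mathrm{tr}_P[Y]$, $p=-\epsilon[Y](n,n)$, $j=\epsilon\big(P([Y](n,\cdot),\cdot)-\epsilon\ell^{(2)}p\,n\big)$, $\boldsymbol j=\gamma(j,\cdot)$ and $\bar\rho=\rho+2P(\nu,\boldsymbol j)+p\,(2\ell^{(2)}+P(\nu,\nu))$, and define the purely gravitational part by $Y^{\mathfrak G}(e_A,e_B)=[Y](e_A,e_B)+\frac{\epsilon\bar\rho}{\mathfrak n-1}\gamma(e_A,e_B)$. Then $\mathfrak h^{AB}[Y](e_A,e_B)=-\epsilon\bar\rho$, and $Y^{\mathfrak G}$ is the $\mathfrak h$-trace-free part of the components $[Y](e_A,e_B)$: one has $[Y](e_A,e_B)=Y^{\mathfrak G}(e_A,e_B)+\frac{\mathfrak h^{IJ}[Y](e_I,e_J)}{\mathfrak n-1}\gamma(e_A,e_B)$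 and $\mathfrak h^{AB}Y^{\mathfrak G}(e_A,e_B)=0$. It does not contribute to the energy-momentum tensor: replacing $[Y]$ by $Y^{\mathfrak G}(e_A,e_B)\,\theta^A\otimes\theta^B$ in the formula for $\tau$ gives $0$. (For $\mathfrak n=1$ there are no indices $A$, and the statements about $e_A$ are void.) -/

import Mathlib

open scoped Manifold ContDiff Bundle Topology

noncomputable section

namespace NullShell

/-! ### Tensor fields, chart representatives and Lie derivatives -/

section Tensors

variable {E : Type*} [NormedAddCommGroup E] [NormedSpace ℝ E]
  {H : Type*} [TopologicalSpace H] (I : ModelWithCorners ℝ E H)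
  (M : Type*) [TopologicalSpace M] [ChartedSpace H M]

/-- Vector fields on `M`. -/
abbrev VField := ∀ x : M, TangentSpace I x

/-- Covector fields on `M`. -/
abbrev Cov1 := ∀ x : M, TangentSpace I x →L[ℝ] ℝ

/-- `2`-covariant tensor fields on `M`. -/
abbrev Cov2 := ∀ x : M, TangentSpace I x →L[ℝ] TangentSpace I x →L[ℝ] ℝ

variable {I M}

/-- Smooth vector fields. -/
def VField.IsSmooth [IsManifold I ∞ M] (X : VField I M) : Prop :=
  ContMDiff I I.tangent ∞ (fun x => (⟨x, X x⟩ : TangentBundle I M))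

/-- Smooth covector fields: smooth sections of the cotangent bundle. -/
def Cov1.IsSmooth [IsManifold I ∞ M] (θ : Cov1 I M) : Prop :=
  ContMDiff I (I.prod 𝓘(ℝ, E →L[ℝ] ℝ)) ∞
    (fun x => Bundle.TotalSpace.mk' (E →L[ℝ] ℝ)
      (E := fun x : M => TangentSpace I x →L[ℝ] ℝ) x (θ x))

/-- Smooth `2`-covariant tensor fields: smooth sections of the bundle of bilinear forms. -/
def Cov2.IsSmooth [IsManifold I ∞ M] (T : Cov2 I M) : Prop :=
  ContMDiff I (I.prod 𝓘(ℝ, E →L[ℝ] E →L[ℝ] ℝ)) ∞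
    (fun x => Bundle.TotalSpace.mk' (E →L[ℝ] E →L[ℝ] ℝ)
      (E := fun x : M => TangentSpace I x →L[ℝ] TangentSpace I x →L[ℝ] ℝ) x (T x))

/-- Symmetric `2`-covariant tensor fields. -/
def Cov2.IsSymm (T : Cov2 I M) : Prop := ∀ x u v, T x u v = T x v u

/-- The bilinear form `(u, v) ↦ B (A u) (A' v)`. -/
def bilinPull {V W : Type*} [TopologicalSpace V] [AddCommGroup V] [Module ℝ V]
    [TopologicalSpace W] [AddCommGroup W] [Module ℝ W]
    (B : W →L[ℝ] W →L[ℝ] ℝ) (A A' : V →L[ℝ] W) : V →L[ℝ] V →L[ℝ] ℝ :=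
  (ContinuousLinearMap.precomp ℝ A') ∘L B ∘L A

@[simp] theorem bilinPull_apply {V W : Type*} [TopologicalSpace V] [AddCommGroup V] [Module ℝ V]
    [TopologicalSpace W] [AddCommGroup W] [Module ℝ W]
    (B : W →L[ℝ] W →L[ℝ] ℝ) (A A' : V →L[ℝ] W) (u v : V) :
    bilinPull B A A' u v = B (A u) (A' v) := rfl

variable (I) in
/-- The differential at `q` of the preferred chart `extChartAt I x₀` around `x₀`:
it sends a tangent vector at `q` to its components in that chart. -/
def chartD (x₀ q : M) : TangentSpace I q →L[ℝ] E := mvfderiv I (extChartAt I x₀) q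

variable (I) in
/-- The differential at `y` of the inverse of the preferred chart around `x₀`:
it sends components in that chart to tangent vectors. -/
def chartDSymm (x₀ : M) (y : E) : E →L[ℝ] TangentSpace I ((extChartAt I x₀).symm y) :=
  (mfderivWithin 𝓘(ℝ, E) I (extChartAt I x₀).symm (Set.range I) y) ∘L
    (NormedSpace.fromTangentSpace y).symm.toContinuousLinearMap

/-- Components of a covector field in the preferred chart around `x₀`, as a function of the
coordinates. -/
def Cov1.rep (θ : Cov1 I M) (x₀ : M) (y : E) : E →L[ℝ] ℝ :=
  (θ ((extChartAt I x₀).symm y)) ∘L chartDSymm I x₀ y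

/-- Components of a `2`-covariant tensor field in the preferred chart around `x₀`, as a function of
the coordinates. -/
def Cov2.rep (T : Cov2 I M) (x₀ : M) (y : E) : E →L[ℝ] E →L[ℝ] ℝ :=
  bilinPull (T ((extChartAt I x₀).symm y)) (chartDSymm I x₀ y) (chartDSymm I x₀ y)

/-- Partial derivatives at `x₀` of the components of a covector field in the preferred chart at
`x₀`: the components `∂_a θ_b`. -/
def Cov1.pderiv (θ : Cov1 I M) (x₀ : M) : E →L[ℝ] E →L[ℝ] ℝ :=
  fderivWithin ℝ (θ.rep x₀) (Set.range I) (extChartAt I x₀ x₀)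

set_option synthInstance.maxHeartbeats 200000 in
/-- Partial derivatives at `x₀` of the components of a `2`-covariant tensor field in the preferred
chart at `x₀`: the components `∂_a T_{bc}`. -/
def Cov2.pderiv (T : Cov2 I M) (x₀ : M) : E →L[ℝ] E →L[ℝ] E →L[ℝ] ℝ :=
  fderivWithin ℝ (T.rep x₀) (Set.range I) (extChartAt I x₀ x₀)

/-- The exterior derivative of a covector field: `(dθ)_{ab} = ∂_a θ_b - ∂_b θ_a`. -/
def Cov1.ext (θ : Cov1 I M) : Cov2 I M := fun p =>
  bilinPull (θ.pderiv p) (chartD I p p) (chartD I p p)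
    - bilinPull (θ.pderiv p).flip (chartD I p p) (chartD I p p)

variable {E' : Type*} [NormedAddCommGroup E'] [NormedSpace ℝ E']
  {H' : Type*} [TopologicalSpace H'] {J : ModelWithCorners ℝ E' H'}
  {N : Type*} [TopologicalSpace N] [ChartedSpace H' N]

/-- Pull-back of a covector field. -/
def Cov1.pullback (θ : Cov1 I M) (J : ModelWithCorners ℝ E' H') {N : Type*} [TopologicalSpace N]
    [ChartedSpace H' N] (f : N → M) : Cov1 J N := fun p => (θ (f p)) ∘L (mfderiv J I f p)

/-- Pull-back of a `2`-covariant tensor field. -/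
def Cov2.pullback (T : Cov2 I M) (J : ModelWithCorners ℝ E' H') {N : Type*} [TopologicalSpace N]
    [ChartedSpace H' N] (f : N → M) : Cov2 J N := fun p =>
  bilinPull (T (f p)) (mfderiv J I f p) (mfderiv J I f p)

/-- Components of a vector field `ζ` along a map `f : N → M`, in the preferred chart of `M`
around `x₀`. -/
def alongRep {f : N → M} (ζ : ∀ p : N, TangentSpace I (f p)) (x₀ : M) (q : N) : E :=
  chartD I x₀ (f q) (ζ q)

/-- The pull-back `f^*(£_ζ T)` of the Lie derivative of a `2`-covariant tensor field `T` on `M`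
along a vector field `ζ` defined along `f : N → M`. In the coordinates `x^α` of `M` around `f p`
and for `u, v` tangent to `N` at `p`, it is the usual expression
`(ζ^μ ∂_μ T_{αβ} + T_{μβ} ∂_α ζ^μ + T_{αμ} ∂_β ζ^μ) (f_* u)^α (f_* v)^β`,
where `(f_* u)^α ∂_α ζ^μ = u(ζ^μ ∘ f)` only involves the values of `ζ` along `f`. So it
coincides with the pull-back of the Lie derivative along any extension of `ζ` off the image
of `f`. -/
def liePull (T : Cov2 I M) (J : ModelWithCorners ℝ E' H') {N : Type*} [TopologicalSpace N]
    [ChartedSpace H' N] {f : N → M} (ζ : ∀ p : N, TangentSpace I (f p)) : Cov2 J N := fun p =>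
  let y := extChartAt I (f p) (f p)
  let df : TangentSpace J p →L[ℝ] E := mvfderiv J (fun q => extChartAt I (f p) (f q)) p
  let dζ : TangentSpace J p →L[ℝ] E := mvfderiv J (alongRep (I := I) ζ (f p)) p
  bilinPull (T.pderiv (f p) (alongRep (I := I) ζ (f p) p)) df df
    + bilinPull (T.rep (f p) y) dζ df + bilinPull (T.rep (f p) y) df dζ

/-- The Lie derivative `£_X T` of a `2`-covariant tensor field, with components
`X^c ∂_c T_{ab} + T_{cb} ∂_a X^c + T_{ac} ∂_b X^c`. -/
def Cov2.lie (X : VField I M) (T : Cov2 I M) : Cov2 I M := liePull T I (f := id) X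

set_option synthInstance.maxHeartbeats 200000 in
theorem Cov2.pderiv_symm (T : Cov2 I M) (hT : T.IsSymm) (p : M) (a b c : E) :
    T.pderiv p a b c = T.pderiv p a c b := by
  have hu : UniqueDiffWithinAt ℝ (Set.range I) (extChartAt I p p) := I.uniqueDiffOn _ (by simp)
  unfold Cov2.pderiv
  by_cases hd : DifferentiableWithinAt ℝ (T.rep p) (Set.range I) (extChartAt I p p)
  · have h := hd.hasFDerivWithinAt
    have h1 := (h.clm_apply (hasFDerivWithinAt_const b _ _)).clm_apply
      (hasFDerivWithinAt_const c _ _)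
    have h2 := (h.clm_apply (hasFDerivWithinAt_const c _ _)).clm_apply
      (hasFDerivWithinAt_const b _ _)
    have h3 : (fun y => T.rep p y b c) = fun y => T.rep p y c b := funext fun y => hT _ _ _
    rw [h3] at h1
    have h4 := congrArg (fun L : E →L[ℝ] ℝ => L a) (hu.eq h1 h2)
    simpa using h4
  · rw [fderivWithin_zero_of_not_differentiableWithinAt hd]
    rfl

theorem Cov2.lie_symm (T : Cov2 I M) (hT : T.IsSymm) (X : VField I M) :
    (T.lie X).IsSymm := by
  intro p u v
  have h (a b : E) (y : E) : T.rep p y a b = T.rep p y b a := hT _ _ _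
  simp only [Cov2.lie, liePull, id_eq, add_apply, bilinPull_apply]
  rw [T.pderiv_symm hT p, h, h (mvfderiv I _ p u)]
  ring

/-- The Lie derivative `£_X θ` of a covector field, with components
`X^c ∂_c θ_a + θ_c ∂_a X^c`. -/
def Cov1.lie (X : VField I M) (θ : Cov1 I M) : Cov1 I M := fun p =>
  (θ.pderiv p (chartD I p p (X p))) ∘L (chartD I p p)
    + (θ.rep p (extChartAt I p p)) ∘L (mvfderiv I (alongRep (I := I) (f := id) X p) p)

/-- The symmetrized product `θ ⊗ₛ η = ½ (θ ⊗ η + η ⊗ θ)` of two covector fields. -/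
def symProd (θ η : Cov1 I M) : Cov2 I M := fun p =>
  (1 / 2 : ℝ) • ((θ p).smulRight (η p) + (η p).smulRight (θ p))

end Tensors

/-! ### Metric hypersurface data -/

section HypersurfaceData

variable {E : Type*} [NormedAddCommGroup E] [NormedSpace ℝ E]
  {H : Type*} [TopologicalSpace H] (I : ModelWithCorners ℝ E H)
  (N : Type*) [TopologicalSpace N] [ChartedSpace H N] [IsManifold I ∞ N]

/-- The ambient bilinear form on `V × ℝ` built from a bilinear form `γ`, a covector `ℓ` and
a number `ℓ₂`: `𝒜((W, a), (Z, b)) = γ(W, Z) + a ℓ(Z) + b ℓ(W) + a b ℓ₂`. -/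
def ambientForm {V : Type*} [TopologicalSpace V] [AddCommGroup V] [Module ℝ V]
    (γ : V →L[ℝ] V →L[ℝ] ℝ) (ℓ : V →L[ℝ] ℝ) (ℓ₂ : ℝ) : LinearMap.BilinForm ℝ (V × ℝ) :=
  LinearMap.mk₂ ℝ
    (fun x y => γ x.1 y.1 + x.2 * ℓ y.1 + y.2 * ℓ x.1 + x.2 * y.2 * ℓ₂)
    (fun x x' y => by simp; ring) (fun c x y => by simp; ring)
    (fun x y y' => by simp; ring) (fun c x y => by simp; ring)

/-- Metric hypersurface data `{N, γ, ℓ, ℓ⁽²⁾}`. -/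
structure MetricHypersurfaceData where
  /-- the symmetric tensor `γ` -/
  γ : Cov2 I N
  /-- the covector field `ℓ` -/
  ell : Cov1 I N
  /-- the scalar `ℓ⁽²⁾` -/
  ell2 : N → ℝ
  γ_smooth : γ.IsSmooth
  ell_smooth : ell.IsSmooth
  ell2_smooth : ContMDiff I 𝓘(ℝ, ℝ) ∞ ell2
  γ_symm : γ.IsSymm
  nondegenerate : ∀ p, (ambientForm (γ p) (ell p) (ell2 p)).Nondegenerate

/-- Hypersurface data `{N, γ, ℓ, ℓ⁽²⁾, Y}`. -/
structure HypersurfaceData extends MetricHypersurfaceData I N where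
  /-- the transverse tensor `Y` -/
  Y : Cov2 I N
  Y_smooth : Y.IsSmooth
  Y_symm : Y.IsSymm

variable {I N}

instance [FiniteDimensional ℝ E] (p : N) : FiniteDimensional ℝ (TangentSpace I p) :=
  inferInstanceAs (FiniteDimensional ℝ E)

namespace MetricHypersurfaceData

variable [FiniteDimensional ℝ E] (D : MetricHypersurfaceData I N)

/-- The isomorphism `T_p N × ℝ ≃ (T_p N × ℝ)^*` defined by the ambient form. -/
def flat (p : N) :
    (TangentSpace I p × ℝ) ≃ₗ[ℝ] Module.Dual ℝ (TangentSpace I p × ℝ) :=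
  (ambientForm (D.γ p) (D.ell p) (D.ell2 p)).toDual (D.nondegenerate p)

/-- The vector field `n`. -/
def n : VField I N := fun p => ((D.flat p).symm (LinearMap.snd ℝ (TangentSpace I p) ℝ)).1

/-- The scalar `n⁽²⁾`. -/
def n2 (p : N) : ℝ := ((D.flat p).symm (LinearMap.snd ℝ (TangentSpace I p) ℝ)).2

/-- The `2`-contravariant tensor `P`, as the map `α ↦ P(α, ·)` from covectors to vectors. -/
def P (p : N) : (TangentSpace I p →L[ℝ] ℝ) →ₗ[ℝ] TangentSpace I p where
  toFun α := ((D.flat p).symm ((α : TangentSpace I p →ₗ[ℝ] ℝ) ∘ₗ LinearMap.fst ℝ _ ℝ)).1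
  map_add' α β := by
    rw [← Prod.fst_add, ← map_add]; rfl
  map_smul' c α := by
    rw [RingHom.id_apply, ← Prod.smul_fst, ← map_smul]; rfl

/-- `P(α, β)`. -/
def P2 (p : N) (α β : TangentSpace I p →L[ℝ] ℝ) : ℝ := β (D.P p α)

/-- Null data: `n⁽²⁾` vanishes identically. -/
def IsNull : Prop := ∀ p, D.n2 p = 0

/-- `F = ½ dℓ`. -/
def F : Cov2 I N := fun p => (1 / 2 : ℝ) • D.ell.ext p

/-- `s = F(n, ·)`. -/
def s : Cov1 I N := fun p => D.F p (D.n p)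

/-- `U = ½ £_n γ + ℓ ⊗ₛ d n⁽²⁾`. -/
def U : Cov2 I N := fun p =>
  (1 / 2 : ℝ) • D.γ.lie D.n p + symProd D.ell (fun q => mvfderiv I D.n2 q) p

theorem flat_symm_spec (p : N) (φ : Module.Dual ℝ (TangentSpace I p × ℝ))
    (y : TangentSpace I p × ℝ) :
    D.γ p ((D.flat p).symm φ).1 y.1 + ((D.flat p).symm φ).2 * D.ell p y.1
      + y.2 * D.ell p ((D.flat p).symm φ).1 + ((D.flat p).symm φ).2 * y.2 * D.ell2 p = φ y := by
  have h := congrArg (fun ψ => ψ y) ((D.flat p).apply_symm_apply φ)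
  exact h

/-- `γ_{ab} n^b + n⁽²⁾ ℓ_a = 0`. -/
theorem prod1 (p : N) (v : TangentSpace I p) : D.γ p (D.n p) v + D.n2 p * D.ell p v = 0 := by
  simpa [n, n2] using D.flat_symm_spec p (LinearMap.snd ℝ _ ℝ) (v, 0)

/-- `ℓ_a n^a + n⁽²⁾ ℓ⁽²⁾ = 1`. -/
theorem prod2 (p : N) : D.ell p (D.n p) + D.n2 p * D.ell2 p = 1 := by
  simpa [n, n2] using D.flat_symm_spec p (LinearMap.snd ℝ _ ℝ) (0, 1)

theorem P_aux (p : N) (α : TangentSpace I p →L[ℝ] ℝ) :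
    ((D.flat p).symm ((α : TangentSpace I p →ₗ[ℝ] ℝ) ∘ₗ LinearMap.fst ℝ _ ℝ)).2
      = α (D.n p) := by
  have h1 := D.flat_symm_spec p ((α : TangentSpace I p →ₗ[ℝ] ℝ) ∘ₗ LinearMap.fst ℝ _ ℝ)
    (D.n p, D.n2 p)
  have h2 := D.flat_symm_spec p (LinearMap.snd ℝ _ ℝ)
    ((D.flat p).symm ((α : TangentSpace I p →ₗ[ℝ] ℝ) ∘ₗ LinearMap.fst ℝ _ ℝ))
  set x := (D.flat p).symm ((α : TangentSpace I p →ₗ[ℝ] ℝ) ∘ₗ LinearMap.fst ℝ _ ℝ)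
  change D.γ p (D.n p) x.1 + D.n2 p * D.ell p x.1 + x.2 * D.ell p (D.n p)
    + D.n2 p * x.2 * D.ell2 p = x.2 at h2
  change D.γ p x.1 (D.n p) + x.2 * D.ell p (D.n p) + D.n2 p * D.ell p x.1
    + x.2 * D.n2 p * D.ell2 p = α (D.n p) at h1
  rw [D.γ_symm] at h1
  linarith

/-- `P^{ab} ℓ_b + ℓ⁽²⁾ n^a = 0`, contracted with an arbitrary covector. -/
theorem prod3 (p : N) (α : TangentSpace I p →L[ℝ] ℝ) :
    D.ell p (D.P p α) + D.ell2 p * α (D.n p) = 0 := by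
  have h := D.flat_symm_spec p ((α : TangentSpace I p →ₗ[ℝ] ℝ) ∘ₗ LinearMap.fst ℝ _ ℝ) (0, 1)
  rw [D.P_aux] at h
  change D.γ p (D.P p α) 0 + α (D.n p) * D.ell p 0 + 1 * D.ell p (D.P p α)
    + α (D.n p) * 1 * D.ell2 p = α 0 at h
  simp only [map_zero] at h
  linarith

/-- `P^{ab} γ_{bc} + n^a ℓ_c = δ^a_c`, contracted with an arbitrary covector and vector. -/
theorem prod4 (p : N) (α : TangentSpace I p →L[ℝ] ℝ) (v : TangentSpace I p) :
    D.γ p (D.P p α) v + α (D.n p) * D.ell p v = α v := by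
  have h := D.flat_symm_spec p ((α : TangentSpace I p →ₗ[ℝ] ℝ) ∘ₗ LinearMap.fst ℝ _ ℝ) (v, 0)
  rw [D.P_aux] at h
  change D.γ p (D.P p α) v + α (D.n p) * D.ell p v + 0 * D.ell p (D.P p α)
    + α (D.n p) * 0 * D.ell2 p = α v at h
  linarith

/-- The connection coefficients of the metric hypersurface connection in the preferred chart
at `p`:
`Γ^d_{ab} = ½ P^{dc} (∂_a γ_{bc} + ∂_b γ_{ac} - ∂_c γ_{ab}) + ½ n^d (∂_a ℓ_b + ∂_b ℓ_a)`. -/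
def christoffel (p : N) (u v : TangentSpace I p) : TangentSpace I p :=
  let c := chartD I p p
  D.P p ((1 / 2 : ℝ) • ((D.γ.pderiv p (c u) (c v) + D.γ.pderiv p (c v) (c u)
      - ((D.γ.pderiv p).flip (c u)).flip (c v)) ∘L c))
    + ((1 / 2 : ℝ) * (D.ell.pderiv p (c u) (c v) + D.ell.pderiv p (c v) (c u))) • D.n p

theorem U_symm : D.U.IsSymm := by
  intro p u v
  have h := D.γ.lie_symm D.γ_symm D.n p u v
  simp only [U, symProd, add_apply, smul_apply, h,
    ContinuousLinearMap.smulRight_apply, smul_eq_mul]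
  ring

/-- The metric hypersurface connection is the torsion-free connection with
`∇_a γ_{bc} = - ℓ_b U_{ac} - ℓ_c U_{ab}` and `∇_a ℓ_b = F_{ab} - ℓ⁽²⁾ U_{ab}`: the coefficients
above are the only symmetric ones satisfying these two equations. -/
theorem christoffel_unique (p : N)
    (B : TangentSpace I p → TangentSpace I p → TangentSpace I p)
    (hB : ∀ u v, B u v = B v u)
    (hγ : ∀ u v w, D.γ.pderiv p (chartD I p p u) (chartD I p p v) (chartD I p p w)
      - D.γ p (B u v) w - D.γ p v (B u w) = - D.ell p v * D.U p u w - D.ell p w * D.U p u v)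
    (hl : ∀ u v, D.ell.pderiv p (chartD I p p u) (chartD I p p v) - D.ell p (B u v)
      = D.F p u v - D.ell2 p * D.U p u v) : B = D.christoffel p := by
  funext u v
  set c := chartD I p p with hc
  set α : TangentSpace I p →L[ℝ] ℝ :=
    (1 / 2 : ℝ) • ((D.γ.pderiv p (c u) (c v) + D.γ.pderiv p (c v) (c u)
      - ((D.γ.pderiv p).flip (c u)).flip (c v)) ∘L c) with hα
  set β : ℝ := (1 / 2 : ℝ) * (D.ell.pderiv p (c u) (c v) + D.ell.pderiv p (c v) (c u)) with hβ
  have key : D.flat p (B u v, - D.U p u v)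
      = ((α : TangentSpace I p →ₗ[ℝ] ℝ) ∘ₗ LinearMap.fst ℝ _ ℝ)
        + β • LinearMap.snd ℝ (TangentSpace I p) ℝ := by
    refine LinearMap.ext fun y => ?_
    obtain ⟨w, b⟩ := y
    change D.γ p (B u v) w + (- D.U p u v) * D.ell p w + b * D.ell p (B u v)
      + (- D.U p u v) * b * D.ell2 p = α w + β * b
    have e1 := hγ u v w
    have e2 := hγ v u w
    have e3 := hγ w u v
    have hF : D.F p u v = - D.F p v u := by
      simp only [F, Cov1.ext, smul_apply, sub_apply,
        bilinPull_apply, ContinuousLinearMap.flip_apply, smul_eq_mul]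
      ring
    have f1 := hl u v
    have f2 := hl v u
    have hα' : α w = (1 / 2 : ℝ) * (D.γ.pderiv p (c u) (c v) (c w)
        + D.γ.pderiv p (c v) (c u) (c w) - D.γ.pderiv p (c w) (c u) (c v)) := by
      simp [hα]
    rw [D.U_symm p w v, D.U_symm p w u, D.γ_symm p u, hB w v, hB w u] at e3
    rw [D.U_symm p v u, D.γ_symm p u, hB v u] at e2
    rw [D.γ_symm p v] at e1
    rw [D.U_symm p v u, hB v u] at f2
    rw [hα']
    have hb : β = D.ell p (B u v) - D.ell2 p * D.U p u v := by
      rw [hβ]; linarith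
    rw [hb]
    have : D.γ.pderiv p (c w) (c u) (c v) = D.γ p (B u w) v + D.γ p (B v w) u
      - D.ell p u * D.U p v w - D.ell p v * D.U p u w := by linarith
    linear_combination (-1 / 2 : ℝ) * e1 + (-1 / 2 : ℝ) * e2 + (1 / 2 : ℝ) * e3
  have h2 := congrArg (fun φ => ((D.flat p).symm φ).1) key
  simp only [LinearEquiv.symm_apply_apply, map_add, map_smul, Prod.fst_add, Prod.smul_fst] at h2
  exact h2

/-- The covariant derivative `(∇_a θ_b) u^a v^b` of a covector field with respect to the metric
hypersurface connection. -/
def nabla (θ : Cov1 I N) (p : N) (u v : TangentSpace I p) : ℝ :=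
  θ.pderiv p (chartD I p p u) (chartD I p p v) - θ p (D.christoffel p u v)

/-- The symmetrized covariant derivative `∇_{(a} θ_{b)} u^a v^b`. -/
def symNabla (θ : Cov1 I N) (p : N) (u v : TangentSpace I p) : ℝ :=
  (1 / 2 : ℝ) * (D.nabla θ p u v + D.nabla θ p v u)

end MetricHypersurfaceData

end HypersurfaceData

/-! ### Embedded hypersurface data, gauge transformations and matching -/

section Matching

variable {E : Type*} [NormedAddCommGroup E] [NormedSpace ℝ E]
  {H : Type*} [TopologicalSpace H] {I : ModelWithCorners ℝ E H}
  {N : Type*} [TopologicalSpace N] [ChartedSpace H N] [IsManifold I ∞ N]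
  {E' : Type*} [NormedAddCommGroup E'] [NormedSpace ℝ E']
  {H' : Type*} [TopologicalSpace H'] {J : ModelWithCorners ℝ E' H'}
  {M : Type*} [TopologicalSpace M] [ChartedSpace H' M] [IsManifold J ∞ M]

variable (J M) in
/-- Smooth Lorentzian metrics, of signature `(-, +, …, +)`. -/
structure LorentzMetric where
  /-- the metric tensor -/
  val : Cov2 J M
  smooth : val.IsSmooth
  symm : val.IsSymm
  lorentzian : ∀ x, ∃ t, val x t t < 0 ∧ ∀ v, val x t v = 0 → v ≠ 0 → 0 < val x v v

/-- A rigging along `ι : N → M`: a smooth vector field along `ι`, nowhere tangent to the image. -/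
structure IsRigging (I : ModelWithCorners ℝ E H) {N : Type*} [TopologicalSpace N]
    [ChartedSpace H N] {ι : N → M} (L : ∀ p : N, TangentSpace J (ι p)) : Prop where
  smooth : ContMDiff I J.tangent ∞ (fun p => (⟨ι p, L p⟩ : TangentBundle J M))
  transversal : ∀ p, L p ∉ Set.range (mfderiv I J ι p)

/-- The transverse tensor `½ ι^*(£_L g)`. -/
def transverseTensor (g : LorentzMetric J M) (I : ModelWithCorners ℝ E H) {N : Type*}
    [TopologicalSpace N] [ChartedSpace H N] {ι : N → M} (L : ∀ p : N, TangentSpace J (ι p)) :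
    Cov2 I N :=
  fun p => (1 / 2 : ℝ) • liePull g.val I L p

/-- The hypersurface data are embedded in `(M, g)` with embedding `ι` and rigging `L`. -/
structure HypersurfaceData.IsEmbedded (D : HypersurfaceData I N) (g : LorentzMetric J M)
    (ι : N → M) (L : ∀ p : N, TangentSpace J (ι p)) : Prop where
  embedding : Manifold.IsSmoothEmbedding I J ∞ ι
  rigging : IsRigging I L
  γ_eq : D.γ = g.val.pullback I ι
  ell_eq : ∀ p v, D.ell p v = g.val (ι p) (L p) (mfderiv I J ι p v)
  ell2_eq : ∀ p, D.ell2 p = g.val (ι p) (L p) (L p)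
  Y_eq : D.Y = transverseTensor g I L

/-- At points of the boundary: vectors pointing outwards (the half-space is `{x | 0 ≤ x 0}`). -/
def IsOutward {m : ℕ} [NeZero m] {M : Type*} [TopologicalSpace M]
    [ChartedSpace (EuclideanHalfSpace m) M] (x : M) (v : TangentSpace (𝓡∂ m) x) : Prop :=
  chartD (𝓡∂ m) x x v 0 < 0

/-- At points of the boundary: vectors pointing inwards. -/
def IsInward {m : ℕ} [NeZero m] {M : Type*} [TopologicalSpace M]
    [ChartedSpace (EuclideanHalfSpace m) M] (x : M) (v : TangentSpace (𝓡∂ m) x) : Prop :=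
  0 < chartD (𝓡∂ m) x x v 0

/-- `ε = 1` and `L` points outwards everywhere, or `ε = -1` and `L` points inwards everywhere. -/
def IsOrientationSign {m : ℕ} [NeZero m] {M : Type*} [TopologicalSpace M]
    [ChartedSpace (EuclideanHalfSpace m) M] {N : Type*} {ι : N → M}
    (L : ∀ p : N, TangentSpace (𝓡∂ m) (ι p)) (ε : ℝ) : Prop :=
  (ε = 1 ∧ ∀ p, IsOutward (ι p) (L p)) ∨ (ε = -1 ∧ ∀ p, IsInward (ι p) (L p))

/-- Gauge transformation of `ℓ`: `z (ℓ + γ(V, ·))`. -/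
def gaugeEll (z : N → ℝ) (V : VField I N) (γ : Cov2 I N) (ell : Cov1 I N) : Cov1 I N :=
  fun p => z p • (ell p + γ p (V p))

/-- Gauge transformation of `ℓ⁽²⁾`: `z² (ℓ⁽²⁾ + 2 ℓ(V) + γ(V, V))`. -/
def gaugeEll2 (z : N → ℝ) (V : VField I N) (γ : Cov2 I N) (ell : Cov1 I N) (ell2 : N → ℝ) :
    N → ℝ :=
  fun p => z p ^ 2 * (ell2 p + 2 * ell p (V p) + γ p (V p) (V p))

/-- The matching conditions for the diffeomorphism `φ`: some gauge transformation (which leaves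
the first entry unchanged) takes `{φ^* γ̂, φ^* ℓ̂, φ^* ℓ̂⁽²⁾}` to `{γ, ℓ, ℓ⁽²⁾}`, and its parameter
`z` satisfies `sign z = - sign ε⁺ sign ε⁻`. -/
def MatchingConditions (D Dh : MetricHypersurfaceData I N) (φ : N ≃ₘ^∞⟮I, I⟯ N)
    (εp εm : ℝ) : Prop :=
  ∃ (z : N → ℝ) (V : VField I N), ContMDiff I 𝓘(ℝ, ℝ) ∞ z ∧ (∀ p, z p ≠ 0) ∧ V.IsSmooth ∧
    Dh.γ.pullback I φ = D.γ ∧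
    gaugeEll z V (Dh.γ.pullback I φ) (Dh.ell.pullback I φ) = D.ell ∧
    gaugeEll2 z V (Dh.γ.pullback I φ) (Dh.ell.pullback I φ) (Dh.ell2 ∘ φ) = D.ell2 ∧
    ∀ p, SignType.sign (z p) = - (SignType.sign εp * SignType.sign εm)

section Rigging

variable [FiniteDimensional ℝ E] (D Dh : MetricHypersurfaceData I N) (φ : N ≃ₘ^∞⟮I, I⟯ N)

/-- The function `z = 1 / (φ^* ℓ̂)(n)`. -/
def matchingZ (p : N) : ℝ := 1 / Dh.ell.pullback I φ p (D.n p)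

/-- The function `P(φ^* ℓ̂, φ^* ℓ̂) - φ^* ℓ̂⁽²⁾`. -/
def matchingQ (p : N) : ℝ :=
  D.P2 p (Dh.ell.pullback I φ p) (Dh.ell.pullback I φ p) - Dh.ell2 (φ p)

/-- The push-forward `φ_* X` of a vector field. -/
def pushforward (X : VField I N) : VField I N := VectorField.mpullback I I φ.symm X

/-- The matching rigging
`ξ⁺ = z' (L⁺ - ι⁺_* φ_* (P(φ^* ℓ̂, ·)) + μ ι⁺_* φ_* n)`, where `φ^* z' = 1 / (φ^* ℓ̂)(n)` and
`φ^* μ = (P(φ^* ℓ̂, φ^* ℓ̂) - φ^* ℓ̂⁽²⁾) / (2 (φ^* ℓ̂)(n))`, as a vector field along `ι⁺`. -/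
def matchingRigging {ι : N → M} (L : ∀ p : N, TangentSpace J (ι p)) :
    ∀ q : N, TangentSpace J (ι q) := fun q =>
  matchingZ D Dh φ (φ.symm q) • (L q
    - mfderiv I J ι q (pushforward φ (fun p => D.P p (Dh.ell.pullback I φ p)) q)
    + (matchingQ D Dh φ (φ.symm q) / (2 * Dh.ell.pullback I φ (φ.symm q) (D.n (φ.symm q)))) •
      mfderiv I J ι q (pushforward φ D.n q))

end Rigging

end Matching

/-! ### The jump and the energy-momentum tensor of the shell -/

section Shell

variable {E : Type*} [NormedAddCommGroup E] [NormedSpace ℝ E] [FiniteDimensional ℝ E]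
  {H : Type*} [TopologicalSpace H] {I : ModelWithCorners ℝ E H}
  {N : Type*} [TopologicalSpace N] [ChartedSpace H N] [IsManifold I ∞ N]

namespace MetricHypersurfaceData

variable (D : MetricHypersurfaceData I N) (ε : ℝ) (T : Cov2 I N) (p : N)

/-- The trace `P^{ab} T_{ab}`. -/
def trP : ℝ := LinearMap.trace ℝ (TangentSpace I p) (D.P p ∘ₗ (T p).toLinearMap)

/-- The energy-momentum tensor
`τ^{df} = ε ((P^{af} n^d + P^{ad} n^f) n^b - (n⁽²⁾ P^{af} P^{bd} + P^{df} n^a n^b)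
  + P^{ab} (n⁽²⁾ P^{df} - n^d n^f)) T_{ab}` of a shell with jump `T`, evaluated as `τ(α, β)`. -/
def energyMomentum (α β : TangentSpace I p →L[ℝ] ℝ) : ℝ :=
  ε * ((T p (D.P p β) (D.n p) * α (D.n p) + T p (D.P p α) (D.n p) * β (D.n p))
    - (D.n2 p * T p (D.P p β) (D.P p α) + D.P2 p α β * T p (D.n p) (D.n p))
    + D.trP T p * (D.n2 p * D.P2 p α β - α (D.n p) * β (D.n p)))

/-- Energy density `ρ = - ε tr_P T`. -/
def energyDensity : ℝ := - ε * D.trP T p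

/-- Pressure `- ε T(n, n)`. -/
def pressure : ℝ := - ε * T p (D.n p) (D.n p)

/-- Energy flux `j = ε (P(T(n, ·), ·) - ε ℓ⁽²⁾ p n)`, `p` being the pressure. -/
def energyFlux : TangentSpace I p :=
  ε • (D.P p (T p (D.n p)) - (ε * D.ell2 p * D.pressure ε T p) • D.n p)

/-- `ρ̄ = ρ + 2 P(ν, 𝐣) + p (2 ℓ⁽²⁾ + P(ν, ν))`, for a covector `ν`, where `𝐣 = γ(j, ·)`. -/
def rhoBar (ν : TangentSpace I p →L[ℝ] ℝ) : ℝ :=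
  D.energyDensity ε T p + 2 * D.P2 p ν (D.γ p (D.energyFlux ε T p))
    + D.pressure ε T p * (2 * D.ell2 p + D.P2 p ν ν)

/-- The purely gravitational part: `Y^𝔊(u, v) = T(u, v) + ε ρ̄ γ(u, v) / (𝔫 - 1)`,
`𝔫` being the dimension of `N`. -/
def gravPart (ν : TangentSpace I p →L[ℝ] ℝ) (u v : TangentSpace I p) : ℝ :=
  T p u v + ε * D.rhoBar ε T p ν / ((Module.finrank ℝ E : ℝ) - 1) * D.γ p u v

/-- `{n, e_A}` is a basis of `T_p N`, and `{ν, θ^A}` is its dual basis. -/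
structure IsAdaptedBasis {d : ℕ} (e : Fin d → TangentSpace I p)
    (ν : TangentSpace I p →L[ℝ] ℝ) (θ : Fin d → TangentSpace I p →L[ℝ] ℝ) : Prop where
  indep : LinearIndependent ℝ (Fin.cons (D.n p) e : Fin (d + 1) → TangentSpace I p)
  span : Submodule.span ℝ (Set.range (Fin.cons (D.n p) e : Fin (d + 1) → TangentSpace I p)) = ⊤
  ν_n : ν (D.n p) = 1
  ν_e : ∀ A, ν (e A) = 0
  θ_n : ∀ A, θ A (D.n p) = 0
  θ_e : ∀ A B, θ A (e B) = if A = B then 1 else 0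

/-- The matrix `𝔥_{AB} = γ(e_A, e_B)`. -/
def hMatrix {d : ℕ} (e : Fin d → TangentSpace I p) : Matrix (Fin d) (Fin d) ℝ :=
  Matrix.of fun A B => D.γ p (e A) (e B)

end MetricHypersurfaceData

end Shell

end NullShell

namespace NullShell

section ChartRepresentatives

variable {E : Type*} [NormedAddCommGroup E] [NormedSpace ℝ E]
  {H : Type*} [TopologicalSpace H] {I : ModelWithCorners ℝ E H}
  {M : Type*} [TopologicalSpace M] [ChartedSpace H M] [IsManifold I ∞ M]

theorem isManifold_one_of_infty : IsManifold I 1 M :=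
  IsManifold.of_le (m := 1) (n := ∞) (by simp)

omit [IsManifold I ∞ M] in
theorem chartD_chartDSymm [IsManifold I 1 M] {x₀ : M} {y : E} (hy : y ∈ (extChartAt I x₀).target)
    (v : E) : chartD I x₀ ((extChartAt I x₀).symm y) (chartDSymm I x₀ y v) = v :=
  congrArg (fun A : E →L[ℝ] E => A v)
    (mfderiv_extChartAt_comp_mfderivWithin_extChartAt_symm (I := I) hy)

omit [IsManifold I ∞ M] in
theorem chartDSymm_chartD [IsManifold I 1 M] {x₀ : M} {y : E}
    (hy : y ∈ (extChartAt I x₀).target) (v : TangentSpace I ((extChartAt I x₀).symm y)) :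
    chartDSymm I x₀ y (chartD I x₀ ((extChartAt I x₀).symm y) v) = v :=
  congrArg (fun A : E →L[ℝ] E => A v)
    (mfderivWithin_extChartAt_symm_comp_mfderiv_extChartAt (I := I) hy)

omit [IsManifold I ∞ M] in
theorem chartD_self [IsManifold I 1 M] (p : M) (v : TangentSpace I p) : chartD I p p v = v :=
  congrArg (fun A : E →L[ℝ] E => A v) (mfderiv_extChartAt_self (I := I) (x := p))

omit [IsManifold I ∞ M] in
theorem chartD_eq_trivializationAt [IsManifold I 1 M] {x₀ q : M} (hq : q ∈ (chartAt H x₀).source)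
    (v : TangentSpace I q) :
    chartD I x₀ q v = (trivializationAt E (TangentSpace I : M → Type _) x₀ ⟨q, v⟩).2 := by
  have h := TangentBundle.continuousLinearMapAt_trivializationAt (I := I) hq
  have h2 := congrArg (fun A : TangentSpace I q →L[ℝ] E => A v) h
  refine Eq.trans ?_ (h2.symm.trans ?_)
  · rfl
  · rw [Bundle.Trivialization.continuousLinearMapAt_apply, Bundle.Trivialization.coe_linearMapAt_of_mem]
    simpa using hq

theorem contMDiffOn_chartDSymm (x₀ : M) (v : E) :
    ContMDiffOn 𝓘(ℝ, E) I.tangent ∞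
      (fun y => (⟨(extChartAt I x₀).symm y, chartDSymm I x₀ y v⟩ : TangentBundle I M))
      (extChartAt I x₀).target := by
  have := isManifold_one_of_infty (I := I) (M := M)
  have hm : Set.MapsTo (fun y => (⟨(extChartAt I x₀).symm y, chartDSymm I x₀ y v⟩ :
      TangentBundle I M)) (extChartAt I x₀).target
      (trivializationAt E (TangentSpace I : M → Type _) x₀).source := by
    intro y hy
    rw [Bundle.Trivialization.mem_source]
    simpa using (extChartAt I x₀).map_target hy
  rw [Bundle.Trivialization.contMDiffOn_iff hm]
  refine ⟨contMDiffOn_extChartAt_symm x₀, ?_⟩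
  refine (contMDiffOn_const (c := v)).congr fun y hy => ?_
  rw [← chartD_eq_trivializationAt, chartD_chartDSymm hy]
  simpa using (extChartAt I x₀).map_target hy

theorem Cov1.IsSmooth.contDiffOn_rep [FiniteDimensional ℝ E] {θ : Cov1 I M} (hθ : θ.IsSmooth)
    (x₀ : M) : ContDiffOn ℝ ∞ (θ.rep x₀) (extChartAt I x₀).target := by
  refine contDiffOn_clm_apply.2 fun a => ?_
  rw [← contMDiffOn_iff_contDiffOn]
  intro y hy
  have h := ContMDiffWithinAt.clm_bundle_apply (E₂ := Bundle.Trivial M ℝ) (F₂ := ℝ)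
    ((hθ _).comp_contMDiffWithinAt y (contMDiffOn_extChartAt_symm x₀ y hy))
    (contMDiffOn_chartDSymm x₀ a y hy)
  exact (Bundle.contMDiffWithinAt_totalSpace.1 h).2

theorem Cov2.IsSmooth.contDiffOn_rep [FiniteDimensional ℝ E] {T : Cov2 I M} (hT : T.IsSmooth)
    (x₀ : M) : ContDiffOn ℝ ∞ (T.rep x₀) (extChartAt I x₀).target := by
  refine contDiffOn_clm_apply.2 fun a => contDiffOn_clm_apply.2 fun b => ?_
  rw [← contMDiffOn_iff_contDiffOn]
  intro y hy
  have h := ContMDiffWithinAt.clm_bundle_apply₂ (E₃ := Bundle.Trivial M ℝ) (F₃ := ℝ)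
    ((hT _).comp_contMDiffWithinAt y (contMDiffOn_extChartAt_symm x₀ y hy))
    (contMDiffOn_chartDSymm x₀ a y hy) (contMDiffOn_chartDSymm x₀ b y hy)
  exact (Bundle.contMDiffWithinAt_totalSpace.1 h).2

end ChartRepresentatives

set_option synthInstance.maxHeartbeats 200000

section RepresentativeValues

variable {E : Type*} [NormedAddCommGroup E] [NormedSpace ℝ E]
  {H : Type*} [TopologicalSpace H] {I : ModelWithCorners ℝ E H}
  {M : Type*} [TopologicalSpace M] [ChartedSpace H M] [IsManifold I 1 M]

theorem Cov1.rep_chartD (θ : Cov1 I M) {x₀ q : M} (hq : q ∈ (extChartAt I x₀).source)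
    (u : TangentSpace I q) :
    θ.rep x₀ (extChartAt I x₀ q) (chartD I x₀ q u) = θ q u := by
  obtain ⟨y, hy, rfl⟩ : ∃ y ∈ (extChartAt I x₀).target, (extChartAt I x₀).symm y = q :=
    ⟨_, (extChartAt I x₀).map_source hq, (extChartAt I x₀).left_inv hq⟩
  rw [(extChartAt I x₀).right_inv hy]
  change θ _ (chartDSymm I x₀ y _) = _
  rw [chartDSymm_chartD hy]

theorem Cov2.rep_chartD (T : Cov2 I M) {x₀ q : M} (hq : q ∈ (extChartAt I x₀).source)
    (u v : TangentSpace I q) :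
    T.rep x₀ (extChartAt I x₀ q) (chartD I x₀ q u) (chartD I x₀ q v) = T q u v := by
  obtain ⟨y, hy, rfl⟩ : ∃ y ∈ (extChartAt I x₀).target, (extChartAt I x₀).symm y = q :=
    ⟨_, (extChartAt I x₀).map_source hq, (extChartAt I x₀).left_inv hq⟩
  rw [(extChartAt I x₀).right_inv hy]
  change T _ (chartDSymm I x₀ y _) (chartDSymm I x₀ y _) = _
  rw [chartDSymm_chartD hy, chartDSymm_chartD hy]

theorem Cov1.rep_self (θ : Cov1 I M) (p : M) (u : TangentSpace I p) :
    θ.rep p (extChartAt I p p) u = θ p u := by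
  have h := θ.rep_chartD (mem_extChartAt_source (I := I) p) u
  rwa [chartD_self] at h

theorem Cov2.rep_self (T : Cov2 I M) (p : M) (u v : TangentSpace I p) :
    T.rep p (extChartAt I p p) u v = T p u v := by
  have h := T.rep_chartD (mem_extChartAt_source (I := I) p) u v
  rwa [chartD_self, chartD_self] at h

end RepresentativeValues

theorem fderiv_bilin_apply {E F : Type*} [NormedAddCommGroup E] [NormedSpace ℝ E]
    [NormedAddCommGroup F] [NormedSpace ℝ F] {G : E → F →L[ℝ] F →L[ℝ] ℝ}
    {G' : E →L[ℝ] F →L[ℝ] F →L[ℝ] ℝ} {A B : E → F} {x : E}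
    (hG : HasFDerivAt G G' x) (hA : DifferentiableAt ℝ A x) (hB : DifferentiableAt ℝ B x) (c : E) :
    fderiv ℝ (fun y => G y (A y) (B y)) x c
      = G' c (A x) (B x) + G x (fderiv ℝ A x c) (B x) + G x (A x) (fderiv ℝ B x c) := by
  rw [((hG.clm_apply hA.hasFDerivAt).clm_apply hB.hasFDerivAt).fderiv]
  simp
  ring

theorem fderiv_clm_apply_apply {E F G : Type*} [NormedAddCommGroup E] [NormedSpace ℝ E]
    [NormedAddCommGroup F] [NormedSpace ℝ F] [NormedAddCommGroup G] [NormedSpace ℝ G]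
    {L : E → F →L[ℝ] G} {A : E → F} {x : E}
    (hL : DifferentiableAt ℝ L x) (hA : DifferentiableAt ℝ A x) (c : E) :
    fderiv ℝ (fun y => L y (A y)) x c = fderiv ℝ L x c (A x) + L x (fderiv ℝ A x c) := by
  rw [fderiv_clm_apply hL hA]
  simp
  abel

section Boundaryless

variable {E : Type*} [NormedAddCommGroup E] [NormedSpace ℝ E]
  {N : Type*} [TopologicalSpace N] [ChartedSpace E N]

theorem target_mem_nhds (p : N) :
    (extChartAt 𝓘(ℝ, E) p).target ∈ 𝓝 (extChartAt 𝓘(ℝ, E) p p) :=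
  extChartAt_target_mem_nhds p

theorem mdifferentiableAt_of_comp_symm {V : Type*} [NormedAddCommGroup V] [NormedSpace ℝ V]
    {h : N → V} {p : N}
    (hh : DifferentiableAt ℝ (fun y => h ((extChartAt 𝓘(ℝ, E) p).symm y))
      (extChartAt 𝓘(ℝ, E) p p)) : MDifferentiableAt 𝓘(ℝ, E) 𝓘(ℝ, V) h p := by
  rw [mdifferentiableAt_iff]
  constructor
  · have h1 : ContinuousAt ((fun y => h ((extChartAt 𝓘(ℝ, E) p).symm y)) ∘
        (extChartAt 𝓘(ℝ, E) p)) p :=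
      ContinuousAt.comp hh.continuousAt (continuousAt_extChartAt p)
    refine h1.congr ?_
    filter_upwards [extChartAt_source_mem_nhds (I := 𝓘(ℝ, E)) p] with q hq
    exact congrArg h ((extChartAt 𝓘(ℝ, E) p).left_inv hq)
  · rw [ModelWithCorners.range_eq_univ, differentiableWithinAt_univ]
    exact hh

theorem mvfderiv_eq_fderiv {V : Type*} [NormedAddCommGroup V] [NormedSpace ℝ V]
    {h : N → V} {p : N} (hh : MDifferentiableAt 𝓘(ℝ, E) 𝓘(ℝ, V) h p) :
    (mvfderiv 𝓘(ℝ, E) h p : E →L[ℝ] V)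
      = fderiv ℝ (fun y => h ((extChartAt 𝓘(ℝ, E) p).symm y)) (extChartAt 𝓘(ℝ, E) p p) := by
  refine hh.mvfderiv.trans ?_
  rw [ModelWithCorners.range_eq_univ, fderivWithin_univ]
  rfl

theorem Cov1.IsSmooth.contDiffAt_rep [FiniteDimensional ℝ E] [IsManifold 𝓘(ℝ, E) ∞ N]
    {θ : Cov1 𝓘(ℝ, E) N} (hθ : θ.IsSmooth) (p : N) :
    ContDiffAt ℝ ∞ (θ.rep p) (extChartAt 𝓘(ℝ, E) p p) :=
  (hθ.contDiffOn_rep p).contDiffAt (target_mem_nhds p)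

theorem Cov2.IsSmooth.contDiffAt_rep [FiniteDimensional ℝ E] [IsManifold 𝓘(ℝ, E) ∞ N]
    {T : Cov2 𝓘(ℝ, E) N} (hT : T.IsSmooth) (p : N) :
    ContDiffAt ℝ ∞ (T.rep p) (extChartAt 𝓘(ℝ, E) p p) :=
  (hT.contDiffOn_rep p).contDiffAt (target_mem_nhds p)

theorem Cov1.hasFDerivAt_rep {θ : Cov1 𝓘(ℝ, E) N} {p : N}
    (hθ : DifferentiableAt ℝ (θ.rep p) (extChartAt 𝓘(ℝ, E) p p)) :
    HasFDerivAt (θ.rep p) (θ.pderiv p) (extChartAt 𝓘(ℝ, E) p p) := by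
  have h := hθ.hasFDerivAt
  rwa [← fderivWithin_univ, ← ModelWithCorners.range_eq_univ 𝓘(ℝ, E)] at h

theorem Cov2.hasFDerivAt_rep {T : Cov2 𝓘(ℝ, E) N} {p : N}
    (hT : DifferentiableAt ℝ (T.rep p) (extChartAt 𝓘(ℝ, E) p p)) :
    HasFDerivAt (T.rep p) (T.pderiv p) (extChartAt 𝓘(ℝ, E) p p) := by
  have h := hT.hasFDerivAt
  rwa [← fderivWithin_univ, ← ModelWithCorners.range_eq_univ 𝓘(ℝ, E)] at h

/-- Components of a vector field in the preferred chart around `p`, as a function of the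
coordinates. -/
def VField.rep (X : VField 𝓘(ℝ, E) N) (p : N) (y : E) : E :=
  chartD 𝓘(ℝ, E) p ((extChartAt 𝓘(ℝ, E) p).symm y) (X ((extChartAt 𝓘(ℝ, E) p).symm y))

theorem VField.rep_self [IsManifold 𝓘(ℝ, E) 1 N] (X : VField 𝓘(ℝ, E) N) (p : N) :
    X.rep p (extChartAt 𝓘(ℝ, E) p p) = X p := by
  have h : ∀ q : N, q = p → chartD 𝓘(ℝ, E) p q (X q) = X p := by
    rintro q rfl
    exact chartD_self q _
  exact h _ (extChartAt_to_inv p)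

theorem chartD_self_eq_id [IsManifold 𝓘(ℝ, E) 1 N] (p : N) :
    (chartD 𝓘(ℝ, E) p p : E →L[ℝ] E) = ContinuousLinearMap.id ℝ E :=
  mfderiv_extChartAt_self (I := 𝓘(ℝ, E)) (x := p)

theorem Cov1.lie_apply [IsManifold 𝓘(ℝ, E) 1 N] (θ : Cov1 𝓘(ℝ, E) N) (X : VField 𝓘(ℝ, E) N) (p : N)
    (hX : DifferentiableAt ℝ (X.rep p) (extChartAt 𝓘(ℝ, E) p p)) (u : E) :
    θ.lie X p u = θ.pderiv p (X.rep p (extChartAt 𝓘(ℝ, E) p p)) u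
      + θ.rep p (extChartAt 𝓘(ℝ, E) p p)
        (fderiv ℝ (X.rep p) (extChartAt 𝓘(ℝ, E) p p) u) := by
  have h := mvfderiv_eq_fderiv (mdifferentiableAt_of_comp_symm
    (h := alongRep (I := 𝓘(ℝ, E)) (f := id) X p) hX)
  rw [X.rep_self]
  have key : ∀ c m : E →L[ℝ] E, c = ContinuousLinearMap.id ℝ E →
      m = fderiv ℝ (X.rep p) (extChartAt 𝓘(ℝ, E) p p) →
      θ.pderiv p (c (X p)) (c u) + θ.rep p (extChartAt 𝓘(ℝ, E) p p) (m u)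
        = θ.pderiv p (X p) u + θ.rep p (extChartAt 𝓘(ℝ, E) p p)
          (fderiv ℝ (X.rep p) (extChartAt 𝓘(ℝ, E) p p) u) := by
    rintro c m rfl rfl
    rfl
  exact key _ _ (chartD_self_eq_id p) h

theorem Cov2.lie_apply [IsManifold 𝓘(ℝ, E) 1 N] (T : Cov2 𝓘(ℝ, E) N) (X : VField 𝓘(ℝ, E) N) (p : N)
    (hX : DifferentiableAt ℝ (X.rep p) (extChartAt 𝓘(ℝ, E) p p)) (u v : E) :
    T.lie X p u v = T.pderiv p (X.rep p (extChartAt 𝓘(ℝ, E) p p)) u v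
      + T.rep p (extChartAt 𝓘(ℝ, E) p p)
        (fderiv ℝ (X.rep p) (extChartAt 𝓘(ℝ, E) p p) u) v
      + T.rep p (extChartAt 𝓘(ℝ, E) p p) u
        (fderiv ℝ (X.rep p) (extChartAt 𝓘(ℝ, E) p p) v) := by
  have h := mvfderiv_eq_fderiv (mdifferentiableAt_of_comp_symm
    (h := alongRep (I := 𝓘(ℝ, E)) (f := id) X p) hX)
  rw [X.rep_self]
  have key : ∀ c m : E →L[ℝ] E, c = ContinuousLinearMap.id ℝ E →
      m = fderiv ℝ (X.rep p) (extChartAt 𝓘(ℝ, E) p p) →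
      T.pderiv p (c (X p)) (c u) (c v) + T.rep p (extChartAt 𝓘(ℝ, E) p p) (m u) (c v)
          + T.rep p (extChartAt 𝓘(ℝ, E) p p) (c u) (m v)
        = T.pderiv p (X p) u v + T.rep p (extChartAt 𝓘(ℝ, E) p p)
          (fderiv ℝ (X.rep p) (extChartAt 𝓘(ℝ, E) p p) u) v
          + T.rep p (extChartAt 𝓘(ℝ, E) p p) u
          (fderiv ℝ (X.rep p) (extChartAt 𝓘(ℝ, E) p p) v) := by
    rintro c m rfl rfl
    rfl
  exact key _ _ (chartD_self_eq_id p) h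

end Boundaryless

section Pullback

variable {E : Type*} [NormedAddCommGroup E] [NormedSpace ℝ E]
  {N : Type*} [TopologicalSpace N] [ChartedSpace E N] [IsManifold 𝓘(ℝ, E) ∞ N]
  {E' : Type*} [NormedAddCommGroup E'] [NormedSpace ℝ E']
  {H' : Type*} [TopologicalSpace H'] {J : ModelWithCorners ℝ E' H'}
  {M : Type*} [TopologicalSpace M] [ChartedSpace H' M] [IsManifold J ∞ M]
  {f : N → M}

omit [IsManifold 𝓘(ℝ, E) ∞ N] [IsManifold J ∞ M] in
theorem eventually_mem_charts (hf : Continuous f) (p : N) :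
    ∀ᶠ y in 𝓝 (extChartAt 𝓘(ℝ, E) p p), y ∈ (extChartAt 𝓘(ℝ, E) p).target ∧
      f ((extChartAt 𝓘(ℝ, E) p).symm y) ∈ (extChartAt J (f p)).source := by
  have h1 : ContinuousAt (fun y => f ((extChartAt 𝓘(ℝ, E) p).symm y))
      (extChartAt 𝓘(ℝ, E) p p) :=
    hf.continuousAt.comp (continuousAt_extChartAt_symm p)
  have h2 : (extChartAt J (f p)).source ∈
      𝓝 (f ((extChartAt 𝓘(ℝ, E) p).symm (extChartAt 𝓘(ℝ, E) p p))) := by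
    rw [extChartAt_to_inv]
    exact extChartAt_source_mem_nhds (f p)
  exact (show ∀ᶠ y in 𝓝 (extChartAt 𝓘(ℝ, E) p p), y ∈ (extChartAt 𝓘(ℝ, E) p).target from
    target_mem_nhds p).and (h1 h2)

omit [IsManifold 𝓘(ℝ, E) ∞ N] [IsManifold J ∞ M] in
theorem contDiffAt_writtenInExtChartAt (hf : ContMDiff 𝓘(ℝ, E) J ∞ f) (p : N) :
    ContDiffAt ℝ ∞ (writtenInExtChartAt 𝓘(ℝ, E) J p f) (extChartAt 𝓘(ℝ, E) p p) := by
  have h := (contMDiffAt_iff.1 (hf p)).2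
  rwa [ModelWithCorners.range_eq_univ, contDiffWithinAt_univ] at h

theorem chartD_mfderiv_chartDSymm (hf : ContMDiff 𝓘(ℝ, E) J ∞ f) {p : N} {y : E}
    (hy : y ∈ (extChartAt 𝓘(ℝ, E) p).target)
    (hfy : f ((extChartAt 𝓘(ℝ, E) p).symm y) ∈ (extChartAt J (f p)).source) (a : E) :
    chartD J (f p) (f ((extChartAt 𝓘(ℝ, E) p).symm y))
      (mfderiv 𝓘(ℝ, E) J f ((extChartAt 𝓘(ℝ, E) p).symm y) (chartDSymm 𝓘(ℝ, E) p y a))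
      = fderiv ℝ (writtenInExtChartAt 𝓘(ℝ, E) J p f) y a := by
  have := isManifold_one_of_infty (I := 𝓘(ℝ, E)) (M := N)
  have := isManifold_one_of_infty (I := J) (M := M)
  have h1 : MDifferentiableAt 𝓘(ℝ, E) 𝓘(ℝ, E) (extChartAt 𝓘(ℝ, E) p).symm y := by
    have h := mdifferentiableWithinAt_extChartAt_symm (I := 𝓘(ℝ, E)) hy
    rwa [ModelWithCorners.range_eq_univ, mdifferentiableWithinAt_univ] at h
  have h2 : MDifferentiableAt 𝓘(ℝ, E) J f ((extChartAt 𝓘(ℝ, E) p).symm y) :=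
    (hf _).mdifferentiableAt (by simp)
  have h3 : MDifferentiableAt J 𝓘(ℝ, E') (extChartAt J (f p))
      (f ((extChartAt 𝓘(ℝ, E) p).symm y)) :=
    mdifferentiableAt_extChartAt (by simpa using hfy)
  have h := h3.hasMFDerivAt.comp y (h2.hasMFDerivAt.comp y h1.hasMFDerivAt)
  have h4 : mfderivWithin 𝓘(ℝ, E) 𝓘(ℝ, E) (extChartAt 𝓘(ℝ, E) p).symm (Set.range 𝓘(ℝ, E)) y
      = mfderiv 𝓘(ℝ, E) 𝓘(ℝ, E) (extChartAt 𝓘(ℝ, E) p).symm y := by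
    rw [ModelWithCorners.range_eq_univ, mfderivWithin_univ]
  have h6 := congrArg (fun A : E →L[ℝ] E' => A a) h.mfderiv
  rw [← mfderiv_eq_fderiv]
  refine Eq.trans ?_ h6.symm
  unfold chartDSymm
  rw [h4]
  rfl

theorem chartD_mfderiv_apply (hf : ContMDiff 𝓘(ℝ, E) J ∞ f) {p : N} {y : E}
    (hy : y ∈ (extChartAt 𝓘(ℝ, E) p).target)
    (hfy : f ((extChartAt 𝓘(ℝ, E) p).symm y) ∈ (extChartAt J (f p)).source)
    (X : VField 𝓘(ℝ, E) N) :
    chartD J (f p) (f ((extChartAt 𝓘(ℝ, E) p).symm y))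
      (mfderiv 𝓘(ℝ, E) J f ((extChartAt 𝓘(ℝ, E) p).symm y) (X ((extChartAt 𝓘(ℝ, E) p).symm y)))
      = fderiv ℝ (writtenInExtChartAt 𝓘(ℝ, E) J p f) y (X.rep p y) := by
  have := isManifold_one_of_infty (I := 𝓘(ℝ, E)) (M := N)
  rw [← chartD_mfderiv_chartDSymm hf hy hfy]
  unfold VField.rep
  rw [chartDSymm_chartD hy]

theorem Cov1.rep_pullback_eventuallyEq (hf : ContMDiff 𝓘(ℝ, E) J ∞ f) (θ : Cov1 J M) (p : N) :
    (θ.pullback 𝓘(ℝ, E) f).rep p =ᶠ[𝓝 (extChartAt 𝓘(ℝ, E) p p)] fun y =>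
      (θ.rep (f p) (writtenInExtChartAt 𝓘(ℝ, E) J p f y)) ∘L
        (fderiv ℝ (writtenInExtChartAt 𝓘(ℝ, E) J p f) y) := by
  have := isManifold_one_of_infty (I := J) (M := M)
  filter_upwards [eventually_mem_charts (J := J) hf.continuous p] with y hy
  ext a
  rw [ContinuousLinearMap.comp_apply, ← chartD_mfderiv_chartDSymm hf hy.1 hy.2]
  exact (θ.rep_chartD hy.2 _).symm

theorem Cov2.rep_pullback_eventuallyEq (hf : ContMDiff 𝓘(ℝ, E) J ∞ f) (T : Cov2 J M) (p : N) :
    (T.pullback 𝓘(ℝ, E) f).rep p =ᶠ[𝓝 (extChartAt 𝓘(ℝ, E) p p)] fun y =>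
      bilinPull (T.rep (f p) (writtenInExtChartAt 𝓘(ℝ, E) J p f y))
        (fderiv ℝ (writtenInExtChartAt 𝓘(ℝ, E) J p f) y)
        (fderiv ℝ (writtenInExtChartAt 𝓘(ℝ, E) J p f) y) := by
  have := isManifold_one_of_infty (I := J) (M := M)
  filter_upwards [eventually_mem_charts (J := J) hf.continuous p] with y hy
  ext a b
  rw [bilinPull_apply, ← chartD_mfderiv_chartDSymm hf hy.1 hy.2,
    ← chartD_mfderiv_chartDSymm hf hy.1 hy.2]
  exact (T.rep_chartD hy.2 _ _).symm

omit [IsManifold 𝓘(ℝ, E) ∞ N] [IsManifold J ∞ M] in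
theorem writtenInExtChartAt_self (p : N) :
    writtenInExtChartAt 𝓘(ℝ, E) J p f (extChartAt 𝓘(ℝ, E) p p) = extChartAt J (f p) (f p) := by
  simp [writtenInExtChartAt]

theorem Cov1.contDiffAt_rep_pullback [FiniteDimensional ℝ E'] (hf : ContMDiff 𝓘(ℝ, E) J ∞ f)
    {θ : Cov1 J M} (hθ : θ.IsSmooth) (p : N) :
    ContDiffAt ℝ ∞ ((θ.pullback 𝓘(ℝ, E) f).rep p) (extChartAt 𝓘(ℝ, E) p p) := by
  refine ContDiffAt.congr_of_eventuallyEq ?_ (Cov1.rep_pullback_eventuallyEq hf θ p)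
  have hF := contDiffAt_writtenInExtChartAt hf p
  refine ContDiffAt.clm_comp ?_ (hF.fderiv_right (by simp))
  rw [← contDiffWithinAt_univ]
  refine ((hθ.contDiffOn_rep (f p)) _ ?_).comp_of_preimage_mem_nhdsWithin _
    hF.contDiffWithinAt ?_
  · rw [writtenInExtChartAt_self]
    exact mem_extChartAt_target (f p)
  · rw [nhdsWithin_univ]
    filter_upwards [eventually_mem_charts (J := J) hf.continuous p] with y hy
    exact (extChartAt J (f p)).map_source hy.2

omit [IsManifold 𝓘(ℝ, E) ∞ N] in
theorem Cov2.hasFDerivAt_rep_comp [FiniteDimensional ℝ E'] (hf : ContMDiff 𝓘(ℝ, E) J ∞ f)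
    {T : Cov2 J M} (hT : T.IsSmooth) (p : N) :
    HasFDerivAt (fun y => T.rep (f p) (writtenInExtChartAt 𝓘(ℝ, E) J p f y))
      (T.pderiv (f p) ∘L fderiv ℝ (writtenInExtChartAt 𝓘(ℝ, E) J p f) (extChartAt 𝓘(ℝ, E) p p))
      (extChartAt 𝓘(ℝ, E) p p) := by
  have hF := (contDiffAt_writtenInExtChartAt hf p).differentiableAt (by simp)
  have h1 : ContDiffWithinAt ℝ ∞ (T.rep (f p)) (Set.range J) (extChartAt J (f p) (f p)) :=
    (hT.contDiffOn_rep (f p) _ (mem_extChartAt_target (f p))).mono_of_mem_nhdsWithin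
      (extChartAt_target_mem_nhdsWithin (f p))
  have h2 := (h1.differentiableWithinAt (by simp)).hasFDerivWithinAt
  rw [← writtenInExtChartAt_self (E := E) (J := J) (f := f) p] at h2
  refine (h2.comp_hasFDerivAt _ hF.hasFDerivAt ?_).congr_fderiv ?_
  · refine Filter.Eventually.of_forall fun y => ?_
    simp [writtenInExtChartAt]
  · rw [writtenInExtChartAt_self]
    rfl

theorem Cov2.pderiv_pullback [FiniteDimensional ℝ E'] (hf : ContMDiff 𝓘(ℝ, E) J ∞ f)
    {T : Cov2 J M} (hT : T.IsSmooth) (p : N) {x : E} (hx : extChartAt 𝓘(ℝ, E) p p = x)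
    {F : E → E'} (hFdef : writtenInExtChartAt 𝓘(ℝ, E) J p f = F)
    (hS : DifferentiableAt ℝ ((T.pullback 𝓘(ℝ, E) f).rep p) x) (a b c : E) :
    (T.pullback 𝓘(ℝ, E) f).pderiv p c a b
      = T.pderiv (f p) (fderiv ℝ F x c) (fderiv ℝ F x a) (fderiv ℝ F x b)
        + T.rep (f p) (F x) (fderiv ℝ (fderiv ℝ F) x c a) (fderiv ℝ F x b)
        + T.rep (f p) (F x) (fderiv ℝ F x a) (fderiv ℝ (fderiv ℝ F) x c b) := by
  subst hx hFdef
  set x := extChartAt 𝓘(ℝ, E) p p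
  set F := writtenInExtChartAt 𝓘(ℝ, E) J p f
  have hF := contDiffAt_writtenInExtChartAt hf p
  have hF2 : DifferentiableAt ℝ (fderiv ℝ F) x :=
    (hF.fderiv_right (m := ∞) (by simp)).differentiableAt (by simp)
  have hG := Cov2.hasFDerivAt_rep_comp hf hT p
  have hpd : HasFDerivAt ((T.pullback 𝓘(ℝ, E) f).rep p)
      ((T.pullback 𝓘(ℝ, E) f).pderiv p) x := Cov2.hasFDerivAt_rep hS
  have e : (fun y => (T.pullback 𝓘(ℝ, E) f).rep p y a b) =ᶠ[𝓝 x]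
      fun y => T.rep (f p) (F y) (fderiv ℝ F y a) (fderiv ℝ F y b) := by
    filter_upwards [Cov2.rep_pullback_eventuallyEq hf T p] with y hy
    rw [hy, bilinPull_apply]
  have e1 := congrArg (fun A : E →L[ℝ] ℝ => A c) e.fderiv_eq
  have hDF : ∀ a : E, HasFDerivAt (fun y => fderiv ℝ F y a)
      ((fderiv ℝ (fderiv ℝ F) x).flip a) x := fun a => by
    simpa using! hF2.hasFDerivAt.clm_apply (hasFDerivAt_const a x)
  have e2 := fderiv_bilin_apply hpd (differentiableAt_const a) (differentiableAt_const b) c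
  have e3 := fderiv_bilin_apply hG (hDF a).differentiableAt (hDF b).differentiableAt c
  rw [(hDF a).fderiv, (hDF b).fderiv] at e3
  simp only [fderiv_fun_const, Pi.zero_apply, zero_apply, map_zero, add_zero] at e2
  exact e2.symm.trans (e1.trans e3)

omit [IsManifold 𝓘(ℝ, E) ∞ N] [IsManifold J ∞ M] in
theorem liePull_apply (T : Cov2 J M) (ζ : ∀ p : N, TangentSpace J (f p)) (p : N)
    {df dζ : E →L[ℝ] E'} {w y : E'}
    (hdf : (mvfderiv 𝓘(ℝ, E) (fun q => extChartAt J (f p) (f q)) p : E →L[ℝ] E') = df)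
    (hdζ : (mvfderiv 𝓘(ℝ, E) (alongRep (I := J) ζ (f p)) p : E →L[ℝ] E') = dζ)
    (hw : alongRep (I := J) ζ (f p) p = w) (hy : extChartAt J (f p) (f p) = y) (u v : E) :
    liePull T 𝓘(ℝ, E) ζ p u v
      = T.pderiv (f p) w (df u) (df v) + T.rep (f p) y (dζ u) (df v)
        + T.rep (f p) y (df u) (dζ v) := by
  subst hdf hdζ hw hy
  rfl

/-- Naturality of the Lie derivative: along the push-forward of a vector field, the pulled back
Lie derivative is the Lie derivative of the pull-back. -/
theorem liePull_mfderiv [FiniteDimensional ℝ E'] (hf : ContMDiff 𝓘(ℝ, E) J ∞ f)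
    {T : Cov2 J M} (hT : T.IsSmooth) (X : VField 𝓘(ℝ, E) N) (p : N)
    (hX : DifferentiableAt ℝ (X.rep p) (extChartAt 𝓘(ℝ, E) p p))
    (hS : DifferentiableAt ℝ ((T.pullback 𝓘(ℝ, E) f).rep p) (extChartAt 𝓘(ℝ, E) p p)) (u v : E) :
    liePull T 𝓘(ℝ, E) (fun q => mfderiv 𝓘(ℝ, E) J f q (X q)) p u v
      = (T.pullback 𝓘(ℝ, E) f).lie X p u v := by
  have i1 := isManifold_one_of_infty (I := 𝓘(ℝ, E)) (M := N)
  set x := extChartAt 𝓘(ℝ, E) p p with hx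
  set F := writtenInExtChartAt 𝓘(ℝ, E) J p f with hFdef
  have hF := contDiffAt_writtenInExtChartAt hf p
  have hF1 : DifferentiableAt ℝ F x := hF.differentiableAt (by simp)
  have hF2 : DifferentiableAt ℝ (fderiv ℝ F) x :=
    (hF.fderiv_right (m := ∞) (by simp)).differentiableAt (by simp)
  have hp := Cov2.pderiv_pullback hf hT p rfl rfl hS
  have hrep := (Cov2.rep_pullback_eventuallyEq hf T p).eq_of_nhds
  have hdf : (mvfderiv 𝓘(ℝ, E) (fun q => extChartAt J (f p) (f q)) p : E →L[ℝ] E')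
      = fderiv ℝ F x :=
    mvfderiv_eq_fderiv (mdifferentiableAt_of_comp_symm hF1)
  have hal : (fun y => alongRep (I := J) (fun q => mfderiv 𝓘(ℝ, E) J f q (X q)) (f p)
      ((extChartAt 𝓘(ℝ, E) p).symm y)) =ᶠ[𝓝 x] fun y => fderiv ℝ F y (X.rep p y) := by
    filter_upwards [eventually_mem_charts (J := J) hf.continuous p] with y hy
    exact chartD_mfderiv_apply hf hy.1 hy.2 X
  have hald : DifferentiableAt ℝ (fun y => alongRep (I := J)
      (fun q => mfderiv 𝓘(ℝ, E) J f q (X q)) (f p) ((extChartAt 𝓘(ℝ, E) p).symm y)) x :=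
    (hF2.clm_apply hX).congr_of_eventuallyEq hal
  have hdz : (mvfderiv 𝓘(ℝ, E) (alongRep (I := J)
      (fun q => mfderiv 𝓘(ℝ, E) J f q (X q)) (f p)) p : E →L[ℝ] E')
      = fderiv ℝ (fun y => fderiv ℝ F y (X.rep p y)) x :=
    (mvfderiv_eq_fderiv (mdifferentiableAt_of_comp_symm hald)).trans hal.fderiv_eq
  have hal0 : alongRep (I := J) (fun q => mfderiv 𝓘(ℝ, E) J f q (X q)) (f p) p
      = fderiv ℝ F x (X.rep p x) := by
    have h := hal.eq_of_nhds
    rwa [hx, extChartAt_to_inv] at h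
  have hsymm : ∀ a b, fderiv ℝ (fderiv ℝ F) x a b = fderiv ℝ (fderiv ℝ F) x b a :=
    
    hF.isSymmSndFDerivAt (by
      rw [minSmoothness_of_isRCLikeNormedField]
      exact WithTop.coe_le_coe.2 le_top)
  rw [liePull_apply T (fun q => mfderiv 𝓘(ℝ, E) J f q (X q)) p hdf hdz hal0
    (writtenInExtChartAt_self (E := E) (J := J) (f := f) p).symm u v, Cov2.lie_apply _ X p hX, hp, hrep]
  rw [fderiv_clm_apply_apply hF2 hX, fderiv_clm_apply_apply hF2 hX, hsymm u, hsymm v,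
    bilinPull_apply, bilinPull_apply]
  simp only [map_add, add_apply]
  ring

end Pullback

section AlongMap

variable {E : Type*} [NormedAddCommGroup E] [NormedSpace ℝ E]
  {N : Type*} [TopologicalSpace N] [ChartedSpace E N]
  {E' : Type*} [NormedAddCommGroup E'] [NormedSpace ℝ E']
  {H' : Type*} [TopologicalSpace H'] {J : ModelWithCorners ℝ E' H'}
  {M : Type*} [TopologicalSpace M] [ChartedSpace H' M]
  {f : N → M}

theorem liePull_symm {T : Cov2 J M} (hT : T.IsSymm) (ζ : ∀ p : N, TangentSpace J (f p)) :
    (liePull T 𝓘(ℝ, E) ζ).IsSymm := by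
  intro p (u : E) (v : E)
  have h (a b : E') (y : E') : T.rep (f p) y a b = T.rep (f p) y b a := hT _ _ _
  obtain ⟨F, hF⟩ : ∃ F : E →L[ℝ] E',
    (mvfderiv 𝓘(ℝ, E) (fun q => extChartAt J (f p) (f q)) p : E →L[ℝ] E') = F := ⟨_, rfl⟩
  obtain ⟨A, hA⟩ : ∃ A : E →L[ℝ] E',
    (mvfderiv 𝓘(ℝ, E) (alongRep (I := J) ζ (f p)) p : E →L[ℝ] E') = A := ⟨_, rfl⟩
  refine (liePull_apply T ζ p hF hA rfl rfl u v).trans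
    (Eq.trans ?_ (liePull_apply T ζ p hF hA rfl rfl v u).symm)
  rw [T.pderiv_symm hT (f p), h (A u), h (F u)]
  ring

/-- Differentiability at `p` of the components of a vector field along `f`. -/
def AlongDiffAt (E : Type*) [NormedAddCommGroup E] [NormedSpace ℝ E] [ChartedSpace E N]
    (ζ : ∀ p : N, TangentSpace J (f p)) (p : N) : Prop :=
  MDifferentiableAt 𝓘(ℝ, E) 𝓘(ℝ, E') (alongRep (I := J) ζ (f p)) p

theorem alongDiffAt_of_contMDiff [IsManifold J ∞ M] {ζ : ∀ p : N, TangentSpace J (f p)}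
    (hf : Continuous f)
    (hζ : ContMDiff 𝓘(ℝ, E) J.tangent ∞ (fun p => (⟨f p, ζ p⟩ : TangentBundle J M))) (p : N) :
    AlongDiffAt E ζ p := by
  have := isManifold_one_of_infty (I := J) (M := M)
  have h := (Bundle.contMDiffAt_totalSpace.1 (hζ p)).2.mdifferentiableAt (by simp)
  refine h.congr_of_eventuallyEq ?_
  filter_upwards [hf.continuousAt.preimage_mem_nhds (chart_source_mem_nhds H' (f p))] with q hq
  exact chartD_eq_trivializationAt hq _

omit [TopologicalSpace N] in
theorem alongRep_add {ζ η : ∀ p : N, TangentSpace J (f p)} (x₀ : M) :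
    alongRep (I := J) (fun q => ζ q + η q) x₀ = alongRep (I := J) ζ x₀ + alongRep (I := J) η x₀ :=
  funext fun _ => map_add _ _ _

omit [TopologicalSpace N] in
theorem alongRep_smul {c : N → ℝ} {ζ : ∀ p : N, TangentSpace J (f p)} (x₀ : M) :
    alongRep (I := J) (fun q => c q • ζ q) x₀ = fun q => c q • alongRep (I := J) ζ x₀ q :=
  funext fun _ => map_smul _ _ _

theorem AlongDiffAt.add {ζ η : ∀ p : N, TangentSpace J (f p)} {p : N} (hζ : AlongDiffAt E ζ p)
    (hη : AlongDiffAt E η p) : AlongDiffAt E (fun q => ζ q + η q) p := by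
  unfold AlongDiffAt
  rw [alongRep_add]
  exact MDifferentiableAt.add hζ hη

theorem AlongDiffAt.smul {c : N → ℝ} {ζ : ∀ p : N, TangentSpace J (f p)} {p : N}
    (hc : MDifferentiableAt 𝓘(ℝ, E) 𝓘(ℝ, ℝ) c p) (hζ : AlongDiffAt E ζ p) :
    AlongDiffAt E (fun q => c q • ζ q) p := by
  unfold AlongDiffAt
  rw [alongRep_smul]
  exact MDifferentiableAt.smul hc hζ

theorem liePull_add (T : Cov2 J M) {ζ η : ∀ p : N, TangentSpace J (f p)} {p : N}
    (hζ : AlongDiffAt E ζ p) (hη : AlongDiffAt E η p) (u v : E) :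
    liePull T 𝓘(ℝ, E) (fun q => ζ q + η q) p u v
      = liePull T 𝓘(ℝ, E) ζ p u v + liePull T 𝓘(ℝ, E) η p u v := by
  obtain ⟨F, hF⟩ : ∃ F : E →L[ℝ] E',
    (mvfderiv 𝓘(ℝ, E) (fun q => extChartAt J (f p) (f q)) p : E →L[ℝ] E') = F := ⟨_, rfl⟩
  obtain ⟨A, hA⟩ : ∃ A : E →L[ℝ] E',
    (mvfderiv 𝓘(ℝ, E) (alongRep (I := J) ζ (f p)) p : E →L[ℝ] E') = A := ⟨_, rfl⟩
  obtain ⟨B, hB⟩ : ∃ B : E →L[ℝ] E',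
    (mvfderiv 𝓘(ℝ, E) (alongRep (I := J) η (f p)) p : E →L[ℝ] E') = B := ⟨_, rfl⟩
  have hd : (mvfderiv 𝓘(ℝ, E) (alongRep (I := J) (fun q => ζ q + η q) (f p)) p : E →L[ℝ] E')
      = A + B := by
    subst hA hB
    rw [alongRep_add]
    exact mvfderiv_add hζ hη
  rw [liePull_apply T (fun q => ζ q + η q) p hF hd (congrFun (alongRep_add (f p)) p) rfl u v,
    liePull_apply T ζ p hF hA rfl rfl u v, liePull_apply T η p hF hB rfl rfl u v]
  simp only [Pi.add_apply, map_add, add_apply]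
  ring

variable [IsManifold 𝓘(ℝ, E) ∞ N] [IsManifold J ∞ M]

omit [IsManifold 𝓘(ℝ, E) ∞ N] in
theorem mvfderiv_extChartAt_comp {p : N} (hf : MDifferentiableAt 𝓘(ℝ, E) J f p)
    (u : TangentSpace 𝓘(ℝ, E) p) :
    mvfderiv 𝓘(ℝ, E) (fun q => extChartAt J (f p) (f q)) p u
      = chartD J (f p) (f p) (mfderiv 𝓘(ℝ, E) J f p u) := by
  have := isManifold_one_of_infty (I := J) (M := M)
  exact congrArg (fun A : E →L[ℝ] E' => A u)
    (mfderiv_comp p (mdifferentiableAt_extChartAt (I := J) (mem_chart_source H' (f p))) hf)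

omit [IsManifold 𝓘(ℝ, E) ∞ N] in
theorem liePull_smul (T : Cov2 J M) {c : N → ℝ} {ζ : ∀ p : N, TangentSpace J (f p)} {p : N}
    (hf : MDifferentiableAt 𝓘(ℝ, E) J f p)
    (hc : MDifferentiableAt 𝓘(ℝ, E) 𝓘(ℝ, ℝ) c p) (hζ : AlongDiffAt E ζ p) (u v : E) :
    liePull T 𝓘(ℝ, E) (fun q => c q • ζ q) p u v
      = c p * liePull T 𝓘(ℝ, E) ζ p u v
        + mvfderiv 𝓘(ℝ, E) c p u * T (f p) (ζ p) (mfderiv 𝓘(ℝ, E) J f p v)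
        + mvfderiv 𝓘(ℝ, E) c p v * T (f p) (mfderiv 𝓘(ℝ, E) J f p u) (ζ p) := by
  have := isManifold_one_of_infty (I := J) (M := M)
  obtain ⟨F, hF⟩ : ∃ F : E →L[ℝ] E',
    (mvfderiv 𝓘(ℝ, E) (fun q => extChartAt J (f p) (f q)) p : E →L[ℝ] E') = F := ⟨_, rfl⟩
  obtain ⟨A, hA⟩ : ∃ A : E →L[ℝ] E',
    (mvfderiv 𝓘(ℝ, E) (alongRep (I := J) ζ (f p)) p : E →L[ℝ] E') = A := ⟨_, rfl⟩
  obtain ⟨dc, hdc⟩ : ∃ dc : E →L[ℝ] ℝ, (mvfderiv 𝓘(ℝ, E) c p : E →L[ℝ] ℝ) = dc := ⟨_, rfl⟩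
  have hd : (mvfderiv 𝓘(ℝ, E) (alongRep (I := J) (fun q => c q • ζ q) (f p)) p : E →L[ℝ] E')
      = c p • A + dc.smulRight (alongRep (I := J) ζ (f p) p) := by
    subst hA hdc
    rw [alongRep_smul]
    exact mvfderiv_smul hc hζ
  have h0 (w : E) : F w = chartD J (f p) (f p) (mfderiv 𝓘(ℝ, E) J f p w) := by
    subst hF
    exact mvfderiv_extChartAt_comp hf w
  have h1 : T.rep (f p) (extChartAt J (f p) (f p)) (alongRep (I := J) ζ (f p) p) (F v)
      = T (f p) (ζ p) (mfderiv 𝓘(ℝ, E) J f p v) := by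
    rw [h0]
    exact T.rep_chartD (mem_extChartAt_source (f p)) _ _
  have h2 : T.rep (f p) (extChartAt J (f p) (f p)) (F u) (alongRep (I := J) ζ (f p) p)
      = T (f p) (mfderiv 𝓘(ℝ, E) J f p u) (ζ p) := by
    rw [h0]
    exact T.rep_chartD (mem_extChartAt_source (f p)) _ _
  have h3 (w : E) : mvfderiv 𝓘(ℝ, E) c p w = dc w := by
    subst hdc
    rfl
  rw [liePull_apply T (fun q => c q • ζ q) p hF hd (congrFun (alongRep_smul (f p)) p) rfl u v,
    liePull_apply T ζ p hF hA rfl rfl u v, ← h1, ← h2, h3, h3]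
  simp only [map_add, map_smul, add_apply, smul_apply,
    ContinuousLinearMap.smulRight_apply, smul_eq_mul]
  ring

omit [IsManifold 𝓘(ℝ, E) ∞ N] in
theorem mvfderiv_comp_self {V : Type*} [NormedAddCommGroup V] [NormedSpace ℝ V] {h : N → V}
    {φ : N → N} {p : N} (hφ : MDifferentiableAt 𝓘(ℝ, E) 𝓘(ℝ, E) φ p)
    (hh : MDifferentiableAt 𝓘(ℝ, E) 𝓘(ℝ, V) h (φ p)) (u : E) :
    (mvfderiv 𝓘(ℝ, E) (fun q => h (φ q)) p : E →L[ℝ] V) u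
      = (mvfderiv 𝓘(ℝ, E) h (φ p) : E →L[ℝ] V) (mfderiv 𝓘(ℝ, E) 𝓘(ℝ, E) φ p u) :=
  congrArg (fun A : E →L[ℝ] V => A u) (mfderiv_comp (g := h) p hh hφ)

omit [IsManifold 𝓘(ℝ, E) ∞ N] in
theorem liePull_pullback (T : Cov2 J M) {φ : N → N} {ζ : ∀ p : N, TangentSpace J (f p)} {p : N}
    (hφ : MDifferentiableAt 𝓘(ℝ, E) 𝓘(ℝ, E) φ p)
    (hf : MDifferentiableAt 𝓘(ℝ, E) J f (φ p)) (hζ : AlongDiffAt E ζ (φ p)) (u v : E) :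
    (liePull T 𝓘(ℝ, E) ζ).pullback 𝓘(ℝ, E) φ p u v
      = liePull T 𝓘(ℝ, E) (f := fun q => f (φ q)) (fun q => ζ (φ q)) p u v := by
  have := isManifold_one_of_infty (I := J) (M := M)
  obtain ⟨F, hF⟩ : ∃ F : E →L[ℝ] E', (mvfderiv 𝓘(ℝ, E)
    (fun q => extChartAt J (f (φ p)) (f (φ q))) p : E →L[ℝ] E') = F := ⟨_, rfl⟩
  obtain ⟨A, hA⟩ : ∃ A : E →L[ℝ] E', (mvfderiv 𝓘(ℝ, E)
    (alongRep (I := J) (f := fun q => f (φ q)) (fun q => ζ (φ q)) (f (φ p))) p : E →L[ℝ] E')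
      = A := ⟨_, rfl⟩
  obtain ⟨F', hF'⟩ : ∃ F : E →L[ℝ] E', (mvfderiv 𝓘(ℝ, E)
    (fun q => extChartAt J (f (φ p)) (f q)) (φ p) : E →L[ℝ] E') = F := ⟨_, rfl⟩
  obtain ⟨A', hA'⟩ : ∃ A : E →L[ℝ] E', (mvfderiv 𝓘(ℝ, E)
    (alongRep (I := J) ζ (f (φ p))) (φ p) : E →L[ℝ] E') = A := ⟨_, rfl⟩
  obtain ⟨dφ, hdφ⟩ : ∃ dφ : E →L[ℝ] E, (mfderiv 𝓘(ℝ, E) 𝓘(ℝ, E) φ p : E →L[ℝ] E) = dφ :=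
    ⟨_, rfl⟩
  have hFF (w : E) : F w = F' (dφ w) := by
    subst hF hF' hdφ
    exact mvfderiv_comp_self hφ ((mdifferentiableAt_extChartAt (I := J)
      (mem_chart_source H' (f (φ p)))).comp (φ p) hf) w
  have hAA (w : E) : A w = A' (dφ w) := by
    subst hA hA' hdφ
    exact mvfderiv_comp_self (h := alongRep (I := J) ζ (f (φ p))) hφ hζ w
  have e : (liePull T 𝓘(ℝ, E) ζ).pullback 𝓘(ℝ, E) φ p u v
      = liePull T 𝓘(ℝ, E) ζ (φ p) (dφ u) (dφ v) := by
    subst hdφ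
    rfl
  rw [e, liePull_apply T ζ (φ p) hF' hA' rfl rfl (dφ u) (dφ v),
    liePull_apply (f := fun q => f (φ q)) T (fun q => ζ (φ q)) p hF hA rfl rfl u v,
    hFF, hFF, hAA, hAA]
  rfl

omit [IsManifold 𝓘(ℝ, E) ∞ N] [IsManifold J ∞ M] in
theorem AlongDiffAt.of_comp_diffeomorph (φ : N ≃ₘ^∞⟮𝓘(ℝ, E), 𝓘(ℝ, E)⟯ N)
    {ζ : ∀ p : N, TangentSpace J (f p)} {p : N}
    (h : AlongDiffAt (f := fun q => f (φ q)) E (fun q => ζ (φ q)) p) :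
    AlongDiffAt E ζ (φ p) := by
  have h1 : MDifferentiableAt 𝓘(ℝ, E) 𝓘(ℝ, E) φ.symm (φ p) :=
    φ.symm.contMDiff.mdifferentiableAt (by simp)
  unfold AlongDiffAt at h
  have h2 : MDifferentiableAt 𝓘(ℝ, E) 𝓘(ℝ, E') (alongRep (I := J) (f := fun q => f (φ q))
      (fun q => ζ (φ q)) (f (φ p))) (φ.symm (φ p)) := by
    rwa [φ.symm_apply_apply]
  refine (h2.comp (φ p) h1).congr_of_eventuallyEq (Filter.Eventually.of_forall fun q => ?_)
  have h3 : ∀ q', q' = q → alongRep (I := J) ζ (f (φ p)) q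
      = alongRep (I := J) ζ (f (φ p)) q' := by
    rintro _ rfl
    rfl
  exact h3 _ (φ.apply_symm_apply q)

theorem alongDiffAt_mfderiv (hf : ContMDiff 𝓘(ℝ, E) J ∞ f) {X : VField 𝓘(ℝ, E) N} {p : N}
    (hX : DifferentiableAt ℝ (X.rep p) (extChartAt 𝓘(ℝ, E) p p)) :
    AlongDiffAt E (fun q => mfderiv 𝓘(ℝ, E) J f q (X q)) p := by
  have hF2 : DifferentiableAt ℝ (fderiv ℝ (writtenInExtChartAt 𝓘(ℝ, E) J p f))
      (extChartAt 𝓘(ℝ, E) p p) :=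
    ((contDiffAt_writtenInExtChartAt hf p).fderiv_right (m := ∞) (by simp)).differentiableAt
      (by simp)
  refine mdifferentiableAt_of_comp_symm ((hF2.clm_apply hX).congr_of_eventuallyEq ?_)
  filter_upwards [eventually_mem_charts (J := J) hf.continuous p] with y hy
  exact chartD_mfderiv_apply hf hy.1 hy.2 X

end AlongMap

/-- The ambient form of `ambientForm` as a continuous bilinear map. -/
def ambientCLM {E : Type*} [NormedAddCommGroup E] [NormedSpace ℝ E]
    (γ : E →L[ℝ] E →L[ℝ] ℝ) (ℓ : E →L[ℝ] ℝ) (ℓ₂ : ℝ) : (E × ℝ) →L[ℝ] (E × ℝ) →L[ℝ] ℝ :=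
  bilinPull γ (ContinuousLinearMap.fst ℝ E ℝ) (ContinuousLinearMap.fst ℝ E ℝ)
    + (ContinuousLinearMap.snd ℝ E ℝ).smulRight (ℓ ∘L ContinuousLinearMap.fst ℝ E ℝ)
    + (ℓ ∘L ContinuousLinearMap.fst ℝ E ℝ).smulRight (ContinuousLinearMap.snd ℝ E ℝ)
    + ℓ₂ • (ContinuousLinearMap.snd ℝ E ℝ).smulRight (ContinuousLinearMap.snd ℝ E ℝ)

theorem ambientCLM_apply {E : Type*} [NormedAddCommGroup E] [NormedSpace ℝ E]
    (γ : E →L[ℝ] E →L[ℝ] ℝ) (ℓ : E →L[ℝ] ℝ) (ℓ₂ : ℝ) (w w' : E × ℝ) :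
    ambientCLM γ ℓ ℓ₂ w w' = γ w.1 w'.1 + w.2 * ℓ w'.1 + w'.2 * ℓ w.1 + w.2 * w'.2 * ℓ₂ := by
  simp [ambientCLM]
  ring

/-- The solution of a smooth family of non-degenerate linear systems is smooth. -/
theorem contDiffAt_of_bilin_eq {E W : Type*} [NormedAddCommGroup E] [NormedSpace ℝ E]
    [NormedAddCommGroup W] [NormedSpace ℝ W] [FiniteDimensional ℝ W]
    {A : E → W →L[ℝ] W →L[ℝ] ℝ} {σ : E → W} {β : E → W →L[ℝ] ℝ} {x : E} {n : WithTop ℕ∞}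
    (hA : ContDiffAt ℝ n A x) (hinj : ∀ w, A x w = 0 → w = 0) (hβ : ContDiffAt ℝ n β x)
    (h : ∀ᶠ y in 𝓝 x, A y (σ y) = β y) : ContDiffAt ℝ n σ x := by
  have := FiniteDimensional.complete ℝ W
  have hdim : Module.finrank ℝ W = Module.finrank ℝ (W →L[ℝ] ℝ) := by
    rw [← (LinearMap.toContinuousLinearMap : (W →ₗ[ℝ] ℝ) ≃ₗ[ℝ] W →L[ℝ] ℝ).finrank_eq]
    exact (Subspace.dual_finrank_eq (K := ℝ) (V := W)).symm
  let e : W ≃L[ℝ] (W →L[ℝ] ℝ) := (LinearMap.linearEquivOfInjective (A x : W →ₗ[ℝ] W →L[ℝ] ℝ)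
    ((injective_iff_map_eq_zero _).2 hinj) hdim).toContinuousLinearEquiv
  have he : (e : W →L[ℝ] W →L[ℝ] ℝ) = A x := by
    ext w
    rfl
  have h1 : ContDiffAt ℝ n (fun y => ContinuousLinearMap.inverse (A y)) x := by
    have h0 : ContDiffAt ℝ n (ContinuousLinearMap.inverse :
        (W →L[ℝ] W →L[ℝ] ℝ) → (W →L[ℝ] ℝ) →L[ℝ] W) (A x) := by
      rw [← he]
      exact contDiffAt_map_inverse e
    exact h0.comp x hA
  refine (h1.clm_apply hβ).congr_of_eventuallyEq ?_
  have h2 : ∀ᶠ y in 𝓝 x, A y ∈ Set.range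
      ((↑) : (W ≃L[ℝ] (W →L[ℝ] ℝ)) → W →L[ℝ] W →L[ℝ] ℝ) := by
    refine hA.continuousAt ?_
    rw [← he]
    exact ContinuousLinearEquiv.nhds e
  filter_upwards [h, h2] with y hy ⟨e', he'⟩
  rw [← hy, ← he', ContinuousLinearMap.inverse_equiv]
  simp

namespace MetricHypersurfaceData

variable {E : Type*} [NormedAddCommGroup E] [NormedSpace ℝ E] [FiniteDimensional ℝ E]
  {N : Type*} [TopologicalSpace N] [ChartedSpace E N] [IsManifold 𝓘(ℝ, E) ∞ N]
  (D : MetricHypersurfaceData 𝓘(ℝ, E) N)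

theorem P_symm (p : N) (α β : TangentSpace 𝓘(ℝ, E) p →L[ℝ] ℝ) : β (D.P p α) = α (D.P p β) := by
  have h1 := D.prod4 p α (D.P p β)
  have h2 := D.prod4 p β (D.P p α)
  have h3 := D.prod3 p α
  have h4 := D.prod3 p β
  rw [D.γ_symm] at h2
  linear_combination h1 - h2 - α (D.n p) * h4 + β (D.n p) * h3

/-- The ambient form in coordinates. -/
def ambientRep (p : N) (y : E) : (E × ℝ) →L[ℝ] (E × ℝ) →L[ℝ] ℝ :=
  ambientCLM (D.γ.rep p y) (D.ell.rep p y) (D.ell2 ((extChartAt 𝓘(ℝ, E) p).symm y))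

theorem contDiffAt_ambientRep (p : N) :
    ContDiffAt ℝ ∞ (D.ambientRep p) (extChartAt 𝓘(ℝ, E) p p) := by
  have h1 := D.γ_smooth.contDiffOn_rep p
  have h2 := D.ell_smooth.contDiffOn_rep p
  have h3 : ContDiffOn ℝ ∞ (fun y => D.ell2 ((extChartAt 𝓘(ℝ, E) p).symm y))
      (extChartAt 𝓘(ℝ, E) p).target := by
    rw [← contMDiffOn_iff_contDiffOn]
    exact D.ell2_smooth.comp_contMDiffOn (contMDiffOn_extChartAt_symm p)
  refine ContDiffOn.contDiffAt (s := (extChartAt 𝓘(ℝ, E) p).target) ?_ (target_mem_nhds p)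
  refine contDiffOn_clm_apply.2 fun w => contDiffOn_clm_apply.2 fun w' => ?_
  unfold ambientRep
  simp only [ambientCLM_apply]
  have h4 (a : E) := h2.clm_apply (contDiffOn_const (c := a))
  exact ((((h1.clm_apply contDiffOn_const).clm_apply contDiffOn_const).add
    (contDiffOn_const.mul (h4 _))).add (contDiffOn_const.mul (h4 _))).add
    (contDiffOn_const.mul h3)

theorem ambientRep_self_injective (p : N) (w : E × ℝ)
    (h : D.ambientRep p (extChartAt 𝓘(ℝ, E) p p) w = 0) : w = 0 := by
  have := isManifold_one_of_infty (I := 𝓘(ℝ, E)) (M := N)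
  have h1 : D.flat p w = 0 := by
    refine LinearMap.ext fun (w' : E × ℝ) => ?_
    have h2 : D.ambientRep p (extChartAt 𝓘(ℝ, E) p p) w w' = 0 := by
      rw [h]
      rfl
    have e1 := D.γ.rep_self p w.1 w'.1
    have e2 := D.ell.rep_self p w.1
    have e3 := D.ell.rep_self p w'.1
    rw [ambientRep, ambientCLM_apply, extChartAt_to_inv] at h2
    change D.γ p w.1 w'.1 + w.2 * D.ell p w'.1 + w'.2 * D.ell p w.1
      + w.2 * w'.2 * D.ell2 p = 0
    rw [← e1, ← e2, ← e3]
    exact h2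
  exact (D.flat p).map_eq_zero_iff.1 h1

omit [FiniteDimensional ℝ E] in
theorem ambientRep_rep (p : N) {y : E} (hy : y ∈ (extChartAt 𝓘(ℝ, E) p).target)
    (X : VField 𝓘(ℝ, E) N) (r : ℝ) (w : E × ℝ) :
    D.ambientRep p y (X.rep p y, r) w
      = D.γ ((extChartAt 𝓘(ℝ, E) p).symm y) (X _) (chartDSymm 𝓘(ℝ, E) p y w.1)
        + r * D.ell.rep p y w.1 + w.2 * D.ell ((extChartAt 𝓘(ℝ, E) p).symm y) (X _)
        + r * w.2 * D.ell2 ((extChartAt 𝓘(ℝ, E) p).symm y) := by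
  have := isManifold_one_of_infty (I := 𝓘(ℝ, E)) (M := N)
  have e : chartDSymm 𝓘(ℝ, E) p y (X.rep p y) = X _ := chartDSymm_chartD hy _
  rw [ambientRep, ambientCLM_apply, ← e]
  rfl

theorem ambientRep_n (p : N) {y : E} (hy : y ∈ (extChartAt 𝓘(ℝ, E) p).target) :
    D.ambientRep p y (D.n.rep p y, D.n2 ((extChartAt 𝓘(ℝ, E) p).symm y))
      = ContinuousLinearMap.snd ℝ E ℝ := by
  refine ContinuousLinearMap.ext fun w => ?_
  rw [D.ambientRep_rep p hy]
  have h1 := D.prod1 ((extChartAt 𝓘(ℝ, E) p).symm y) (chartDSymm 𝓘(ℝ, E) p y w.1)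
  have h2 := D.prod2 ((extChartAt 𝓘(ℝ, E) p).symm y)
  change _ + _ * D.ell _ (chartDSymm 𝓘(ℝ, E) p y w.1) + _ + _ = w.2
  linear_combination h1 + w.2 * h2

theorem ambientRep_P (θ : Cov1 𝓘(ℝ, E) N) (p : N) {y : E}
    (hy : y ∈ (extChartAt 𝓘(ℝ, E) p).target) :
    D.ambientRep p y (VField.rep (fun q => D.P q (θ q)) p y, θ.rep p y (D.n.rep p y))
      = (θ.rep p y) ∘L ContinuousLinearMap.fst ℝ E ℝ := by
  have := isManifold_one_of_infty (I := 𝓘(ℝ, E)) (M := N)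
  refine ContinuousLinearMap.ext fun w => ?_
  rw [D.ambientRep_rep p hy]
  have e : θ.rep p y (D.n.rep p y) = θ ((extChartAt 𝓘(ℝ, E) p).symm y) (D.n _) :=
    congrArg (θ ((extChartAt 𝓘(ℝ, E) p).symm y)) (chartDSymm_chartD hy _)
  have h1 := D.prod4 ((extChartAt 𝓘(ℝ, E) p).symm y) (θ _) (chartDSymm 𝓘(ℝ, E) p y w.1)
  have h2 := D.prod3 ((extChartAt 𝓘(ℝ, E) p).symm y) (θ _)
  rw [e]
  change _ + _ * D.ell _ (chartDSymm 𝓘(ℝ, E) p y w.1) + _ + _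
    = θ _ (chartDSymm 𝓘(ℝ, E) p y w.1)
  linear_combination h1 + w.2 * h2

theorem contDiffAt_rep_n (p : N) : ContDiffAt ℝ ∞ (D.n.rep p) (extChartAt 𝓘(ℝ, E) p p) := by
  have h := contDiffAt_of_bilin_eq (σ := fun y =>
      (D.n.rep p y, D.n2 ((extChartAt 𝓘(ℝ, E) p).symm y)))
    (D.contDiffAt_ambientRep p) (D.ambientRep_self_injective p)
    (contDiffAt_const (c := ContinuousLinearMap.snd ℝ E ℝ))
    (Filter.eventually_of_mem (target_mem_nhds p) fun y hy => D.ambientRep_n p hy)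
  exact h.fst

theorem contDiffAt_rep_P {θ : Cov1 𝓘(ℝ, E) N} {p : N}
    (hθ : ContDiffAt ℝ ∞ (θ.rep p) (extChartAt 𝓘(ℝ, E) p p)) :
    ContDiffAt ℝ ∞ (VField.rep (fun q => D.P q (θ q)) p) (extChartAt 𝓘(ℝ, E) p p) := by
  have h := contDiffAt_of_bilin_eq (σ := fun y =>
      (VField.rep (fun q => D.P q (θ q)) p y, θ.rep p y (D.n.rep p y)))
    (D.contDiffAt_ambientRep p) (D.ambientRep_self_injective p)
    (hθ.clm_comp contDiffAt_const)
    (Filter.eventually_of_mem (target_mem_nhds p) fun y hy => D.ambientRep_P θ p hy)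
  exact h.fst

theorem γ_rep_n {D : MetricHypersurfaceData 𝓘(ℝ, E) N} (hD : D.IsNull) (p : N) {y : E}
    (hy : y ∈ (extChartAt 𝓘(ℝ, E) p).target) (b : E) :
    D.γ.rep p y (D.n.rep p y) b = 0 := by
  have h := congrArg (fun φ => φ (b, 0)) (D.ambientRep_n p hy)
  simpa [ambientRep, ambientCLM_apply, hD _] using h

theorem ell_rep_n {D : MetricHypersurfaceData 𝓘(ℝ, E) N} (hD : D.IsNull) (p : N) {y : E}
    (hy : y ∈ (extChartAt 𝓘(ℝ, E) p).target) :
    D.ell.rep p y (D.n.rep p y) = 1 := by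
  have h := congrArg (fun φ => φ (0, 1)) (D.ambientRep_n p hy)
  simpa [ambientRep, ambientCLM_apply, hD _] using h

theorem γ_rep_P (θ : Cov1 𝓘(ℝ, E) N) (p : N) {y : E}
    (hy : y ∈ (extChartAt 𝓘(ℝ, E) p).target) (b : E) :
    D.γ.rep p y (VField.rep (fun q => D.P q (θ q)) p y) b
      = θ.rep p y b - θ.rep p y (D.n.rep p y) * D.ell.rep p y b := by
  have h := congrArg (fun φ => φ (b, 0)) (D.ambientRep_P θ p hy)
  simp [ambientRep, ambientCLM_apply] at h
  linarith

end MetricHypersurfaceData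

namespace MetricHypersurfaceData

variable {E : Type*} [NormedAddCommGroup E] [NormedSpace ℝ E] [FiniteDimensional ℝ E]
  {N : Type*} [TopologicalSpace N] [ChartedSpace E N] [IsManifold 𝓘(ℝ, E) ∞ N]
  (D : MetricHypersurfaceData 𝓘(ℝ, E) N)

omit [FiniteDimensional ℝ E] in
theorem γ_rep_symm (p : N) (y a b : E) : D.γ.rep p y a b = D.γ.rep p y b a := D.γ_symm _ _ _

theorem hasFDerivAt_γ_rep (p : N) :
    HasFDerivAt (D.γ.rep p) (D.γ.pderiv p) (extChartAt 𝓘(ℝ, E) p p) :=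
  Cov2.hasFDerivAt_rep ((D.γ_smooth.contDiffAt_rep p).differentiableAt (by simp))

theorem hasFDerivAt_ell_rep (p : N) :
    HasFDerivAt (D.ell.rep p) (D.ell.pderiv p) (extChartAt 𝓘(ℝ, E) p p) :=
  Cov1.hasFDerivAt_rep ((D.ell_smooth.contDiffAt_rep p).differentiableAt (by simp))

theorem differentiableAt_rep_n (p : N) :
    DifferentiableAt ℝ (D.n.rep p) (extChartAt 𝓘(ℝ, E) p p) :=
  (D.contDiffAt_rep_n p).differentiableAt (by simp)

variable {D} in
theorem pderiv_γ_n (hD : D.IsNull) (p : N) (c b : E) :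
    D.γ.pderiv p c (D.n.rep p (extChartAt 𝓘(ℝ, E) p p)) b
      + D.γ.rep p (extChartAt 𝓘(ℝ, E) p p)
        (fderiv ℝ (D.n.rep p) (extChartAt 𝓘(ℝ, E) p p) c) b = 0 := by
  have e : (fun y => D.γ.rep p y (D.n.rep p y) b) =ᶠ[𝓝 (extChartAt 𝓘(ℝ, E) p p)]
      fun _ => 0 :=
    Filter.eventually_of_mem (target_mem_nhds p) fun y hy => γ_rep_n hD p hy b
  have h := fderiv_bilin_apply (D.hasFDerivAt_γ_rep p) (D.differentiableAt_rep_n p)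
    (differentiableAt_const b) c
  rw [e.fderiv_eq] at h
  simp only [fderiv_fun_const, Pi.zero_apply, zero_apply, map_zero, add_zero] at h
  exact h.symm

variable {D} in
theorem pderiv_ell_n (hD : D.IsNull) (p : N) (c : E) :
    D.ell.pderiv p c (D.n.rep p (extChartAt 𝓘(ℝ, E) p p))
      + D.ell.rep p (extChartAt 𝓘(ℝ, E) p p)
        (fderiv ℝ (D.n.rep p) (extChartAt 𝓘(ℝ, E) p p) c) = 0 := by
  have e : (fun y => D.ell.rep p y (D.n.rep p y)) =ᶠ[𝓝 (extChartAt 𝓘(ℝ, E) p p)]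
      fun _ => 1 :=
    Filter.eventually_of_mem (target_mem_nhds p) fun y hy => ell_rep_n hD p hy
  have h := fderiv_clm_apply_apply (D.hasFDerivAt_ell_rep p).differentiableAt
    (D.differentiableAt_rep_n p) c
  rw [e.fderiv_eq, (D.hasFDerivAt_ell_rep p).fderiv] at h
  simp only [fderiv_fun_const, Pi.zero_apply, zero_apply] at h
  exact h.symm

/-- The function `θ(n)` in coordinates. -/
def evalN (θ : Cov1 𝓘(ℝ, E) N) (p : N) (y : E) : ℝ := θ.rep p y (D.n.rep p y)

theorem contDiffAt_evalN {θ : Cov1 𝓘(ℝ, E) N} {p : N}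
    (hθ : ContDiffAt ℝ ∞ (θ.rep p) (extChartAt 𝓘(ℝ, E) p p)) :
    ContDiffAt ℝ ∞ (D.evalN θ p) (extChartAt 𝓘(ℝ, E) p p) :=
  hθ.clm_apply (D.contDiffAt_rep_n p)

theorem fderiv_evalN {θ : Cov1 𝓘(ℝ, E) N} {p : N}
    (hθ : ContDiffAt ℝ ∞ (θ.rep p) (extChartAt 𝓘(ℝ, E) p p)) (c : E) :
    fderiv ℝ (D.evalN θ p) (extChartAt 𝓘(ℝ, E) p p) c
      = θ.pderiv p c (D.n.rep p (extChartAt 𝓘(ℝ, E) p p))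
        + θ.rep p (extChartAt 𝓘(ℝ, E) p p)
          (fderiv ℝ (D.n.rep p) (extChartAt 𝓘(ℝ, E) p p) c) := by
  have hθ' := hθ.differentiableAt (by simp)
  have h := fderiv_clm_apply_apply hθ' (D.differentiableAt_rep_n p) c
  rw [(Cov1.hasFDerivAt_rep hθ').fderiv] at h
  exact h

theorem pderiv_γ_P {θ : Cov1 𝓘(ℝ, E) N} {p : N}
    (hθ : ContDiffAt ℝ ∞ (θ.rep p) (extChartAt 𝓘(ℝ, E) p p)) (c b : E) :
    D.γ.pderiv p c (VField.rep (fun q => D.P q (θ q)) p (extChartAt 𝓘(ℝ, E) p p)) b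
      + D.γ.rep p (extChartAt 𝓘(ℝ, E) p p)
        (fderiv ℝ (VField.rep (fun q => D.P q (θ q)) p) (extChartAt 𝓘(ℝ, E) p p) c) b
      = θ.pderiv p c b
        - fderiv ℝ (D.evalN θ p) (extChartAt 𝓘(ℝ, E) p p) c
          * D.ell.rep p (extChartAt 𝓘(ℝ, E) p p) b
        - D.evalN θ p (extChartAt 𝓘(ℝ, E) p p) * D.ell.pderiv p c b := by
  have e : (fun y => D.γ.rep p y (VField.rep (fun q => D.P q (θ q)) p y) b)
      =ᶠ[𝓝 (extChartAt 𝓘(ℝ, E) p p)] fun y => θ.rep p y b - D.evalN θ p y * D.ell.rep p y b :=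
    Filter.eventually_of_mem (target_mem_nhds p) fun y hy => D.γ_rep_P θ p hy b
  have hW := (D.contDiffAt_rep_P hθ).differentiableAt (by simp)
  have hθ' := hθ.differentiableAt (by simp)
  have h := fderiv_bilin_apply (D.hasFDerivAt_γ_rep p) hW (differentiableAt_const b) c
  have hb {η : E → E →L[ℝ] ℝ} {η' : E →L[ℝ] E →L[ℝ] ℝ}
      (h : HasFDerivAt η η' (extChartAt 𝓘(ℝ, E) p p)) :
      HasFDerivAt (fun y => η y b) (η'.flip b) (extChartAt 𝓘(ℝ, E) p p) := by
    simpa using! h.clm_apply (hasFDerivAt_const b (extChartAt 𝓘(ℝ, E) p p))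
  have h2 := ((hb (Cov1.hasFDerivAt_rep hθ')).sub
    (((D.contDiffAt_evalN hθ).differentiableAt (by simp)).hasFDerivAt.mul
      (hb (D.hasFDerivAt_ell_rep p)))).fderiv
  have h3 := congrArg (fun A : E →L[ℝ] ℝ => A c) (e.fderiv_eq.trans h2)
  simp only [fderiv_fun_const, Pi.zero_apply, zero_apply, map_zero, add_zero] at h
  rw [← h]
  refine h3.trans ?_
  simp only [sub_apply, add_apply, smul_apply, smul_eq_mul, ContinuousLinearMap.flip_apply]
  ring

theorem apply_christoffel (θ : Cov1 𝓘(ℝ, E) N) (p : N) (u v : E) :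
    θ p (D.christoffel p u v) = (1 / 2 : ℝ) *
      (D.γ.pderiv p u v (D.P p (θ p)) + D.γ.pderiv p v u (D.P p (θ p))
        - D.γ.pderiv p (D.P p (θ p)) u v)
      + (1 / 2 : ℝ) * (D.ell.pderiv p u v + D.ell.pderiv p v u) * θ p (D.n p) := by
  have := isManifold_one_of_infty (I := 𝓘(ℝ, E)) (M := N)
  have h0 (α : TangentSpace 𝓘(ℝ, E) p →L[ℝ] ℝ) (k : ℝ) :
      θ p (D.P p α + k • D.n p) = α (D.P p (θ p)) + k • θ p (D.n p) := by
    rw [map_add, map_smul, D.P_symm]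
  have key : ∀ (c : E →L[ℝ] E) (w : E) (r : ℝ), c = ContinuousLinearMap.id ℝ E →
      ((1 / 2 : ℝ) • ((D.γ.pderiv p (c u) (c v) + D.γ.pderiv p (c v) (c u)
        - ((D.γ.pderiv p).flip (c u)).flip (c v)) ∘L c)) w
      + ((1 / 2 : ℝ) * (D.ell.pderiv p (c u) (c v) + D.ell.pderiv p (c v) (c u))) • r
      = (1 / 2 : ℝ) * (D.γ.pderiv p u v w + D.γ.pderiv p v u w - D.γ.pderiv p w u v)
      + (1 / 2 : ℝ) * (D.ell.pderiv p u v + D.ell.pderiv p v u) * r := by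
    rintro c w r rfl
    simp
  exact (h0 _ _).trans (key _ _ _ (chartD_self_eq_id p))

theorem nabla_apply (θ : Cov1 𝓘(ℝ, E) N) (p : N) (u v : E) :
    D.nabla θ p u v = θ.pderiv p u v - ((1 / 2 : ℝ) *
      (D.γ.pderiv p u v (VField.rep (fun q => D.P q (θ q)) p (extChartAt 𝓘(ℝ, E) p p))
        + D.γ.pderiv p v u (VField.rep (fun q => D.P q (θ q)) p (extChartAt 𝓘(ℝ, E) p p))
        - D.γ.pderiv p (VField.rep (fun q => D.P q (θ q)) p (extChartAt 𝓘(ℝ, E) p p)) u v)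
      + (1 / 2 : ℝ) * (D.ell.pderiv p u v + D.ell.pderiv p v u)
        * D.evalN θ p (extChartAt 𝓘(ℝ, E) p p)) := by
  have := isManifold_one_of_infty (I := 𝓘(ℝ, E)) (M := N)
  have e : D.evalN θ p (extChartAt 𝓘(ℝ, E) p p) = θ p (D.n p) := by
    unfold evalN
    rw [VField.rep_self]
    exact θ.rep_self p _
  rw [VField.rep_self, e, ← D.apply_christoffel]
  have key : ∀ c : E →L[ℝ] E, c = ContinuousLinearMap.id ℝ E →
      θ.pderiv p (c u) (c v) = θ.pderiv p u v := by
    rintro c rfl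
    rfl
  exact congrArg (· - _) (key _ (chartD_self_eq_id p))

/-- The Lie derivative of `γ` along `P(θ, ·)`. -/
theorem lie_γ_P {θ : Cov1 𝓘(ℝ, E) N} {p : N}
    (hθ : ContDiffAt ℝ ∞ (θ.rep p) (extChartAt 𝓘(ℝ, E) p p)) (u v : E) :
    (1 / 2 : ℝ) * D.γ.lie (fun q => D.P q (θ q)) p u v
      = D.symNabla θ p u v - (1 / 2 : ℝ) *
        (fderiv ℝ (D.evalN θ p) (extChartAt 𝓘(ℝ, E) p p) u * D.ell p v
          + fderiv ℝ (D.evalN θ p) (extChartAt 𝓘(ℝ, E) p p) v * D.ell p u) := by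
  have := isManifold_one_of_infty (I := 𝓘(ℝ, E)) (M := N)
  have h1 := D.pderiv_γ_P hθ u v
  have h2 := D.pderiv_γ_P hθ v u
  have e1 : D.ell.rep p (extChartAt 𝓘(ℝ, E) p p) v = D.ell p v := D.ell.rep_self p v
  have e2 : D.ell.rep p (extChartAt 𝓘(ℝ, E) p p) u = D.ell p u := D.ell.rep_self p u
  rw [e1] at h1
  rw [e2] at h2
  have hs : D.symNabla θ p u v = (1 / 2 : ℝ) * (D.nabla θ p u v + D.nabla θ p v u) := rfl
  rw [hs, D.nabla_apply θ p u v, D.nabla_apply θ p v u,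
    Cov2.lie_apply _ _ p ((D.contDiffAt_rep_P hθ).differentiableAt (by simp)),
    D.γ_rep_symm p _ u, D.γ.pderiv_symm D.γ_symm p _ v u,
    D.γ.pderiv_symm D.γ_symm p u v, D.γ.pderiv_symm D.γ_symm p v u]
  linear_combination (1 / 2 : ℝ) * h1 + (1 / 2 : ℝ) * h2

variable {D} in
theorem U_apply (hD : D.IsNull) (p : N) (u v : TangentSpace 𝓘(ℝ, E) p) :
    D.U p u v = (1 / 2 : ℝ) * D.γ.lie D.n p u v := by
  have h : mvfderiv 𝓘(ℝ, E) D.n2 p = 0 := by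
    rw [show D.n2 = fun _ => 0 from funext hD]
    exact mvfderiv_const 0
  have h2 : symProd D.ell (fun q => mvfderiv 𝓘(ℝ, E) D.n2 q) p = 0 := by
    rw [symProd, h, ContinuousLinearMap.zero_smulRight]
    ext a b
    simp
  simp only [U, add_apply, h2, zero_apply, add_zero, smul_apply, smul_eq_mul]

variable {D} in
theorem symNabla_n (hD : D.IsNull) {θ : Cov1 𝓘(ℝ, E) N} {p : N}
    (hθ : ContDiffAt ℝ ∞ (θ.rep p) (extChartAt 𝓘(ℝ, E) p p)) (u : E) :
    D.symNabla θ p (D.n p) u = (1 / 2 : ℝ) * θ.lie D.n p u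
      + (1 / 2 : ℝ) * fderiv ℝ (D.evalN θ p) (extChartAt 𝓘(ℝ, E) p p) u
      - D.P2 p (θ p) (D.U p u) - θ p (D.n p) * D.s p u := by
  have := isManifold_one_of_infty (I := 𝓘(ℝ, E)) (M := N)
  set x := extChartAt 𝓘(ℝ, E) p p
  obtain ⟨n, hn⟩ : ∃ n : E, D.n.rep p x = n := ⟨_, rfl⟩
  obtain ⟨w, hw⟩ : ∃ w : E, VField.rep (fun q => D.P q (θ q)) p x = w := ⟨_, rfl⟩
  have en : D.n p = n := (D.n.rep_self p).symm.trans hn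
  have ew : D.P p (θ p) = w := (VField.rep_self (fun q => D.P q (θ q)) p).symm.trans hw
  have et : D.evalN θ p x = θ p (D.n p) := by
    unfold evalN
    rw [VField.rep_self]
    exact θ.rep_self p _
  have hsu : D.s p u = (1 / 2 : ℝ) * (D.ell.pderiv p n u - D.ell.pderiv p u n) := by
    have key : ∀ c : E →L[ℝ] E, c = ContinuousLinearMap.id ℝ E →
        (1 / 2 : ℝ) * (D.ell.pderiv p (c n) (c u) - D.ell.pderiv p (c u) (c n))
          = (1 / 2 : ℝ) * (D.ell.pderiv p n u - D.ell.pderiv p u n) := by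
      rintro c rfl
      rfl
    rw [s, en]
    exact key _ (chartD_self_eq_id p)
  have hU : D.P2 p (θ p) (D.U p u) = (1 / 2 : ℝ) * (D.γ.pderiv p n u w
      + D.γ.rep p x (fderiv ℝ (D.n.rep p) x u) w
      + D.γ.rep p x (fderiv ℝ (D.n.rep p) x w) u) := by
    have h := U_apply hD p u w
    rw [Cov2.lie_apply _ _ p (D.differentiableAt_rep_n p), hn, D.γ_rep_symm p _ u] at h
    rw [P2, ew]
    exact h
  have hlie := θ.lie_apply D.n p (D.differentiableAt_rep_n p) u
  have hdt := D.fderiv_evalN hθ u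
  have n1 := pderiv_γ_n hD p u w
  have n2 := pderiv_γ_n hD p w u
  have n3 := pderiv_ell_n hD p u
  have hwP : D.γ.rep p x w (fderiv ℝ (D.n.rep p) x u)
      = θ.rep p x (fderiv ℝ (D.n.rep p) x u)
        - D.evalN θ p x * D.ell.rep p x (fderiv ℝ (D.n.rep p) x u) := by
    have h := D.γ_rep_P θ p (mem_extChartAt_target p) (fderiv ℝ (D.n.rep p) x u)
    rwa [hw] at h
  have g1 := D.nabla_apply θ p n u
  have g2 := D.nabla_apply θ p u n
  rw [hw] at g1 g2
  rw [D.γ_rep_symm p x w] at hwP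
  change D.evalN θ p x = _ at et
  rw [hn] at hlie hdt n1 n2 n3
  have hs : D.symNabla θ p n u = (1 / 2 : ℝ) * (D.nabla θ p n u + D.nabla θ p u n) := rfl
  rw [en, hs, hU, hsu, ← en, ← et, en, g1, g2, hlie, hdt]
  rw [D.γ.pderiv_symm D.γ_symm p w u n]
  have s1 := D.γ.pderiv_symm D.γ_symm p u n w
  linear_combination (-1 / 2 : ℝ) * n1 + (1 / 2 : ℝ) * n2 + hwP - D.evalN θ p x * n3

end MetricHypersurfaceData

section ScalarFunctions

variable {E : Type*} [NormedAddCommGroup E] [NormedSpace ℝ E]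
  {N : Type*} [TopologicalSpace N] [ChartedSpace E N] [IsManifold 𝓘(ℝ, E) ∞ N]

omit [IsManifold 𝓘(ℝ, E) ∞ N] in
theorem contMDiffAt_of_comp_symm {h : N → ℝ} {p : N}
    (hh : ContDiffAt ℝ ∞ (fun y => h ((extChartAt 𝓘(ℝ, E) p).symm y))
      (extChartAt 𝓘(ℝ, E) p p)) : ContMDiffAt 𝓘(ℝ, E) 𝓘(ℝ, ℝ) ∞ h p := by
  refine (hh.contMDiffAt.comp p (contMDiffAt_extChartAt (I := 𝓘(ℝ, E)))).congr_of_eventuallyEq ?_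
  filter_upwards [extChartAt_source_mem_nhds (I := 𝓘(ℝ, E)) p] with q hq
  exact congrArg h ((extChartAt 𝓘(ℝ, E) p).left_inv hq).symm

end ScalarFunctions

namespace MetricHypersurfaceData

variable {E : Type*} [NormedAddCommGroup E] [NormedSpace ℝ E] [FiniteDimensional ℝ E]
  {N : Type*} [TopologicalSpace N] [ChartedSpace E N] [IsManifold 𝓘(ℝ, E) ∞ N]
  (D : MetricHypersurfaceData 𝓘(ℝ, E) N) {θ : Cov1 𝓘(ℝ, E) N}

theorem evalN_eq (p : N) {y : E} (hy : y ∈ (extChartAt 𝓘(ℝ, E) p).target) :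
    D.evalN θ p y = θ ((extChartAt 𝓘(ℝ, E) p).symm y) (D.n _) := by
  have := isManifold_one_of_infty (I := 𝓘(ℝ, E)) (M := N)
  exact congrArg (θ ((extChartAt 𝓘(ℝ, E) p).symm y)) (chartDSymm_chartD hy _)

theorem evalN_self (p : N) :
    D.evalN θ p (extChartAt 𝓘(ℝ, E) p p) = θ p (D.n p) := by
  have := isManifold_one_of_infty (I := 𝓘(ℝ, E)) (M := N)
  unfold evalN
  rw [VField.rep_self]
  exact θ.rep_self p _

theorem inv_apply_n_eventuallyEq (p : N) :
    (fun y => 1 / θ ((extChartAt 𝓘(ℝ, E) p).symm y) (D.n _))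
      =ᶠ[𝓝 (extChartAt 𝓘(ℝ, E) p p)] fun y => (D.evalN θ p y)⁻¹ :=
  Filter.eventually_of_mem (target_mem_nhds p) fun y hy => by
    simp only [D.evalN_eq p hy, one_div]

theorem contMDiffAt_inv_apply_n {p : N}
    (hθ : ContDiffAt ℝ ∞ (θ.rep p) (extChartAt 𝓘(ℝ, E) p p)) (h0 : θ p (D.n p) ≠ 0) :
    ContMDiffAt 𝓘(ℝ, E) 𝓘(ℝ, ℝ) ∞ (fun q => 1 / θ q (D.n q)) p := by
  refine contMDiffAt_of_comp_symm (ContDiffAt.congr_of_eventuallyEq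
    ((D.contDiffAt_evalN hθ).inv ?_) (D.inv_apply_n_eventuallyEq p))
  rwa [D.evalN_self]

theorem mvfderiv_inv_apply_n {p : N}
    (hθ : ContDiffAt ℝ ∞ (θ.rep p) (extChartAt 𝓘(ℝ, E) p p)) (h0 : θ p (D.n p) ≠ 0) (u : E) :
    (mvfderiv 𝓘(ℝ, E) (fun q => 1 / θ q (D.n q)) p : E →L[ℝ] ℝ) u
      = - fderiv ℝ (D.evalN θ p) (extChartAt 𝓘(ℝ, E) p p) u / θ p (D.n p) ^ 2 := by
  have h1 := mvfderiv_eq_fderiv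
    ((D.contMDiffAt_inv_apply_n hθ h0).mdifferentiableAt (by simp))
  have h2 := (hasDerivAt_inv (𝕜 := ℝ) (x := D.evalN θ p (extChartAt 𝓘(ℝ, E) p p))
    (by rwa [D.evalN_self])).comp_hasFDerivAt _
    ((D.contDiffAt_evalN hθ).differentiableAt (by simp)).hasFDerivAt
  have h3 := congrArg (fun A : E →L[ℝ] ℝ => A u)
    (h1.trans ((D.inv_apply_n_eventuallyEq p).fderiv_eq.trans h2.fderiv))
  refine h3.trans ?_
  simp only [smul_apply, smul_eq_mul, D.evalN_self]
  ring

theorem mdifferentiableAt_P2 {p : N}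
    (hθ : ContDiffAt ℝ ∞ (θ.rep p) (extChartAt 𝓘(ℝ, E) p p)) :
    MDifferentiableAt 𝓘(ℝ, E) 𝓘(ℝ, ℝ) (fun q => D.P2 q (θ q) (θ q)) p := by
  have := isManifold_one_of_infty (I := 𝓘(ℝ, E)) (M := N)
  refine (contMDiffAt_of_comp_symm (ContDiffAt.congr_of_eventuallyEq
    (hθ.clm_apply (D.contDiffAt_rep_P hθ)) ?_)).mdifferentiableAt (by simp)
  refine Filter.eventually_of_mem (target_mem_nhds p) fun y hy => ?_
  exact congrArg (θ ((extChartAt 𝓘(ℝ, E) p).symm y)) (chartDSymm_chartD hy _).symm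

end MetricHypersurfaceData

section Jump

variable {E : Type*} [NormedAddCommGroup E] [NormedSpace ℝ E] [FiniteDimensional ℝ E]
  {N : Type*} [TopologicalSpace N] [ChartedSpace E N] [IsManifold 𝓘(ℝ, E) ∞ N]
  {E' : Type*} [NormedAddCommGroup E'] [NormedSpace ℝ E'] [FiniteDimensional ℝ E']
  {H' : Type*} [TopologicalSpace H'] {J : ModelWithCorners ℝ E' H'}
  {M : Type*} [TopologicalSpace M] [ChartedSpace H' M] [IsManifold J ∞ M]
  (D Dh : MetricHypersurfaceData 𝓘(ℝ, E) N) (φ : N ≃ₘ^∞⟮𝓘(ℝ, E), 𝓘(ℝ, E)⟯ N)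

omit [FiniteDimensional ℝ E] [IsManifold 𝓘(ℝ, E) ∞ N] in
theorem pushforward_apply (X : VField 𝓘(ℝ, E) N) (p : N) :
    pushforward φ X (φ p) = mfderiv 𝓘(ℝ, E) 𝓘(ℝ, E) φ p (X p) := by
  have h1 : MDifferentiableAt 𝓘(ℝ, E) 𝓘(ℝ, E) φ p := φ.contMDiff.mdifferentiableAt (by simp)
  have h2 : MDifferentiableAt 𝓘(ℝ, E) 𝓘(ℝ, E) φ.symm (φ p) :=
    φ.symm.contMDiff.mdifferentiableAt (by simp)
  obtain ⟨A, hA⟩ : ∃ A : E →L[ℝ] E, (mfderiv 𝓘(ℝ, E) 𝓘(ℝ, E) φ p : E →L[ℝ] E) = A := ⟨_, rfl⟩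
  obtain ⟨B, hB⟩ : ∃ B : E →L[ℝ] E,
    (mfderiv 𝓘(ℝ, E) 𝓘(ℝ, E) φ.symm (φ p) : E →L[ℝ] E) = B := ⟨_, rfl⟩
  have hBA : B ∘L A = ContinuousLinearMap.id ℝ E := by
    have h := mfderiv_comp p h2 h1
    have e : φ.symm ∘ φ = id := funext φ.symm_apply_apply
    rw [e, mfderiv_id] at h
    subst hA hB
    exact h.symm
  have hAB : A ∘L B = ContinuousLinearMap.id ℝ E := by
    have h1' : MDifferentiableAt 𝓘(ℝ, E) 𝓘(ℝ, E) φ (φ.symm (φ p)) := by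
      rwa [φ.symm_apply_apply]
    have h := mfderiv_comp (φ p) h1' h2
    have e : φ ∘ φ.symm = id := funext φ.apply_symm_apply
    have e2 : ∀ q, q = p → (mfderiv 𝓘(ℝ, E) 𝓘(ℝ, E) φ q : E →L[ℝ] E) = A := by
      rintro _ rfl
      exact hA
    rw [e, mfderiv_id] at h
    have e3 := e2 _ (φ.symm_apply_apply p)
    subst hB
    refine Eq.trans ?_ h.symm
    rw [← e3]
    rfl
  have hX : ∀ q, q = p → (X q : E) = X p := by
    rintro _ rfl
    rfl
  have hinv : B.inverse = A := ContinuousLinearMap.inverse_eq hBA hAB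
  subst hA
  have e : pushforward φ X (φ p) = B.inverse (X (φ.symm (φ p))) := by
    subst hB
    rfl
  rw [e, hinv]
  exact congrArg _ (hX _ (φ.symm_apply_apply p))

variable {D Dh φ} {ι : N → M} {L : ∀ p : N, TangentSpace J (ι p)}

omit [FiniteDimensional ℝ E'] [IsManifold J ∞ M] in
theorem matchingRigging_comp (hι : ContMDiff 𝓘(ℝ, E) J ∞ ι) (p : N) :
    matchingRigging D Dh φ L (φ p) = matchingZ D Dh φ p • (L (φ p)
      - mfderiv 𝓘(ℝ, E) J (fun q => ι (φ q)) p (D.P p (Dh.ell.pullback 𝓘(ℝ, E) φ p))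
      + (matchingQ D Dh φ p / (2 * Dh.ell.pullback 𝓘(ℝ, E) φ p (D.n p))) •
        mfderiv 𝓘(ℝ, E) J (fun q => ι (φ q)) p (D.n p)) := by
  have hcomp (u : TangentSpace 𝓘(ℝ, E) p) : mfderiv 𝓘(ℝ, E) J (fun q => ι (φ q)) p u
      = mfderiv 𝓘(ℝ, E) J ι (φ p) (mfderiv 𝓘(ℝ, E) 𝓘(ℝ, E) φ p u) :=
    congrArg (fun A : E →L[ℝ] E' => A u) (mfderiv_comp (g := ι) p
      (hι.mdifferentiableAt (by simp)) (φ.contMDiff.mdifferentiableAt (by simp)))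
  obtain ⟨k, hk⟩ : ∃ k : N → ℝ, ∀ q, k q =
    matchingQ D Dh φ q / (2 * Dh.ell.pullback 𝓘(ℝ, E) φ q (D.n q)) := ⟨_, fun _ => rfl⟩
  rw [hcomp, hcomp, ← pushforward_apply φ D.n p,
    ← pushforward_apply φ (fun q => D.P q (Dh.ell.pullback 𝓘(ℝ, E) φ q)) p, ← hk,
    matchingRigging, ← hk, φ.symm_apply_apply]

end Jump

section Jump

variable {E : Type*} [NormedAddCommGroup E] [NormedSpace ℝ E] [FiniteDimensional ℝ E]
  {N : Type*} [TopologicalSpace N] [ChartedSpace E N] [IsManifold 𝓘(ℝ, E) ∞ N]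
  {E' : Type*} [NormedAddCommGroup E'] [NormedSpace ℝ E'] [FiniteDimensional ℝ E']
  {H' : Type*} [TopologicalSpace H'] {J : ModelWithCorners ℝ E' H'}
  {M : Type*} [TopologicalSpace M] [ChartedSpace H' M] [IsManifold J ∞ M]
  {D Dh : MetricHypersurfaceData 𝓘(ℝ, E) N} {φ : N ≃ₘ^∞⟮𝓘(ℝ, E), 𝓘(ℝ, E)⟯ N}
  {g : LorentzMetric J M} {ι : N → M} {L : ∀ p : N, TangentSpace J (ι p)}

omit [FiniteDimensional ℝ E] [IsManifold 𝓘(ℝ, E) ∞ N] [FiniteDimensional ℝ E']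
  [IsManifold J ∞ M] in
theorem mfderiv_comp_diffeomorph (hι : ContMDiff 𝓘(ℝ, E) J ∞ ι)
    (p : N) (u : TangentSpace 𝓘(ℝ, E) p) :
    mfderiv 𝓘(ℝ, E) J (fun q => ι (φ q)) p u
      = mfderiv 𝓘(ℝ, E) J ι (φ p) (mfderiv 𝓘(ℝ, E) 𝓘(ℝ, E) φ p u) :=
  congrArg (fun A : E →L[ℝ] E' => A u) (mfderiv_comp (g := ι) p
    (hι.mdifferentiableAt (by simp)) (φ.contMDiff.mdifferentiableAt (by simp)))

omit [FiniteDimensional ℝ E] [IsManifold 𝓘(ℝ, E) ∞ N] [FiniteDimensional ℝ E']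
  [IsManifold J ∞ M] in
theorem Cov2.pullback_pullback (hι : ContMDiff 𝓘(ℝ, E) J ∞ ι) (T : Cov2 J M) :
    (T.pullback 𝓘(ℝ, E) ι).pullback 𝓘(ℝ, E) φ = T.pullback 𝓘(ℝ, E) (fun q => ι (φ q)) := by
  funext p
  refine ContinuousLinearMap.ext fun u => ContinuousLinearMap.ext fun v => ?_
  have h1 := mfderiv_comp_diffeomorph (φ := φ) hι p u
  have h2 := mfderiv_comp_diffeomorph (φ := φ) hι p v
  change T _ (mfderiv 𝓘(ℝ, E) J ι (φ p) (mfderiv 𝓘(ℝ, E) 𝓘(ℝ, E) φ p u))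
    (mfderiv 𝓘(ℝ, E) J ι (φ p) (mfderiv 𝓘(ℝ, E) 𝓘(ℝ, E) φ p v)) =
    T _ (mfderiv 𝓘(ℝ, E) J (fun q => ι (φ q)) p u) (mfderiv 𝓘(ℝ, E) J (fun q => ι (φ q)) p v)
  rw [h1, h2]

/-- The pull-back of the transverse tensor of the matching rigging. -/
theorem transverseTensor_matchingRigging (hι : ContMDiff 𝓘(ℝ, E) J ∞ ι)
    (hL : ContMDiff 𝓘(ℝ, E) J.tangent ∞ (fun p => (⟨ι p, L p⟩ : TangentBundle J M)))
    (hγ : Dh.γ = g.val.pullback 𝓘(ℝ, E) ι)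
    (hell : ∀ p v, Dh.ell p v = g.val (ι p) (L p) (mfderiv 𝓘(ℝ, E) J ι p v))
    (hD : D.IsNull) (hφ : Dh.γ.pullback 𝓘(ℝ, E) φ = D.γ)
    (hn : ∀ p, Dh.ell.pullback 𝓘(ℝ, E) φ p (D.n p) ≠ 0) (p : N) (u v : E) :
    (transverseTensor g 𝓘(ℝ, E) (matchingRigging D Dh φ L)).pullback 𝓘(ℝ, E) φ p u v
      = matchingZ D Dh φ p * ((transverseTensor g 𝓘(ℝ, E) L).pullback 𝓘(ℝ, E) φ p u v
        + matchingZ D Dh φ p / 2 * matchingQ D Dh φ p * D.U p u v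
        - D.symNabla (Dh.ell.pullback 𝓘(ℝ, E) φ) p u v) := by
  have i1 := isManifold_one_of_infty (I := 𝓘(ℝ, E)) (M := N)
  have hφd : ContMDiff 𝓘(ℝ, E) 𝓘(ℝ, E) ∞ φ := φ.contMDiff
  have hf : ContMDiff 𝓘(ℝ, E) J ∞ (fun q => ι (φ q)) := hι.comp hφd
  obtain ⟨ϑ, hϑ⟩ : ∃ ϑ : Cov1 𝓘(ℝ, E) N, Dh.ell.pullback 𝓘(ℝ, E) φ = ϑ := ⟨_, rfl⟩
  have hϑs (q : N) : ContDiffAt ℝ ∞ (ϑ.rep q) (extChartAt 𝓘(ℝ, E) q q) := by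
    rw [← hϑ]
    exact Cov1.contDiffAt_rep_pullback hφd Dh.ell_smooth q
  rw [hϑ]
  simp only [hϑ] at hn
  -- the metric on the range of the differential
  have hgf : g.val.pullback 𝓘(ℝ, E) (fun q => ι (φ q)) = D.γ := by
    rw [← Cov2.pullback_pullback (φ := φ) hι, ← hγ, hφ]
  have hgf' (a b : TangentSpace 𝓘(ℝ, E) p) : g.val (ι (φ p))
      (mfderiv 𝓘(ℝ, E) J (fun q => ι (φ q)) p a) (mfderiv 𝓘(ℝ, E) J (fun q => ι (φ q)) p b)
      = D.γ p a b := by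
    rw [← hgf]
    rfl
  have hgL (b : TangentSpace 𝓘(ℝ, E) p) : g.val (ι (φ p)) (L (φ p))
      (mfderiv 𝓘(ℝ, E) J (fun q => ι (φ q)) p b) = ϑ p b := by
    rw [mfderiv_comp_diffeomorph hι, ← hell, ← hϑ]
    rfl
  -- the rigging and its ingredients
  obtain ⟨μ, hμ⟩ : ∃ μ : N → ℝ, ∀ q, matchingQ D Dh φ q / (2 * ϑ q (D.n q)) = μ q :=
    ⟨_, fun _ => rfl⟩
  obtain ⟨X₁, hX₁⟩ : ∃ X₁ : ∀ q, TangentSpace J (ι (φ q)), ∀ q,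
    X₁ q = mfderiv 𝓘(ℝ, E) J (fun q => ι (φ q)) q (D.P q (ϑ q)) := ⟨_, fun _ => rfl⟩
  obtain ⟨X₂, hX₂⟩ : ∃ X₂ : ∀ q, TangentSpace J (ι (φ q)), ∀ q,
    X₂ q = mfderiv 𝓘(ℝ, E) J (fun q => ι (φ q)) q (D.n q) := ⟨_, fun _ => rfl⟩
  have hξ : (fun q => matchingRigging D Dh φ L (φ q)) = fun q => matchingZ D Dh φ q •
      ((L (φ q) + (-1 : ℝ) • X₁ q) + μ q • X₂ q) := by
    funext q
    rw [matchingRigging_comp hι, hX₁, hX₂, ← hμ, hϑ, neg_one_smul, ← sub_eq_add_neg]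
  have dL (q : N) : AlongDiffAt (f := fun q => ι (φ q)) E (fun q => L (φ q)) q :=
    alongDiffAt_of_contMDiff hf.continuous (hL.comp hφd) q
  have dX₁ (q : N) : AlongDiffAt (f := fun q => ι (φ q)) E X₁ q := by
    rw [show X₁ = _ from funext hX₁]
    exact alongDiffAt_mfderiv (X := fun q => D.P q (ϑ q)) hf
      ((D.contDiffAt_rep_P (hϑs q)).differentiableAt (by simp))
  have dX₂ (q : N) : AlongDiffAt (f := fun q => ι (φ q)) E X₂ q := by
    rw [show X₂ = _ from funext hX₂]
    exact alongDiffAt_mfderiv (X := D.n) hf (D.differentiableAt_rep_n q)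
  have dc (q : N) : MDifferentiableAt 𝓘(ℝ, E) 𝓘(ℝ, ℝ) (fun _ : N => (-1 : ℝ)) q :=
    mdifferentiableAt_const
  have hz : matchingZ D Dh φ = fun q => 1 / ϑ q (D.n q) := by
    funext q
    rw [matchingZ, hϑ]
  have dz (q : N) : MDifferentiableAt 𝓘(ℝ, E) 𝓘(ℝ, ℝ) (matchingZ D Dh φ) q := by
    rw [hz]
    exact (D.contMDiffAt_inv_apply_n (hϑs q) (hn q)).mdifferentiableAt (by simp)
  have dμ (q : N) : MDifferentiableAt 𝓘(ℝ, E) 𝓘(ℝ, ℝ) μ q := by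
    have e : μ = fun q => ((1 / 2 : ℝ) • (fun q => 1 / ϑ q (D.n q)) *
        ((fun q => D.P2 q (ϑ q) (ϑ q)) - (fun q => Dh.ell2 (φ q)))) q := by
      funext q
      rw [← hμ, matchingQ, hϑ]
      simp only [Pi.smul_apply, Pi.mul_apply, Pi.sub_apply, smul_eq_mul]
      field_simp
    rw [e]
    refine MDifferentiableAt.mul (MDifferentiableAt.const_smul ?_ _)
      ((D.mdifferentiableAt_P2 (hϑs q)).sub ?_)
    · exact (D.contMDiffAt_inv_apply_n (hϑs q) (hn q)).mdifferentiableAt (by simp)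
    · exact (Dh.ell2_smooth.comp hφd).mdifferentiableAt (by simp)
  have d1 (q : N) := (dL q).add ((dX₁ q).smul (dc q))
  have d2 (q : N) := (d1 q).add ((dX₂ q).smul (dμ q))
  have d3 (q : N) := (d2 q).smul (dz q)
  have dξ : AlongDiffAt E (matchingRigging D Dh φ L) (φ p) := by
    refine AlongDiffAt.of_comp_diffeomorph φ ?_
    rw [hξ]
    exact d3 p
  have dfp : MDifferentiableAt 𝓘(ℝ, E) J (fun q => ι (φ q)) p := hf.mdifferentiableAt (by simp)
  have dφp : MDifferentiableAt 𝓘(ℝ, E) 𝓘(ℝ, E) φ p := hφd.mdifferentiableAt (by simp)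
  have dιp : MDifferentiableAt 𝓘(ℝ, E) J ι (φ p) := hι.mdifferentiableAt (by simp)
  -- pull-backs of the transverse tensors
  have hY1 : (transverseTensor g 𝓘(ℝ, E) (matchingRigging D Dh φ L)).pullback 𝓘(ℝ, E) φ p u v
      = (1 / 2 : ℝ) * liePull g.val 𝓘(ℝ, E) (f := fun q => ι (φ q))
        (fun q => matchingRigging D Dh φ L (φ q)) p u v :=
    congrArg ((1 / 2 : ℝ) * ·) (liePull_pullback g.val dφp dιp dξ u v)
  have hY2 : (transverseTensor g 𝓘(ℝ, E) L).pullback 𝓘(ℝ, E) φ p u v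
      = (1 / 2 : ℝ) * liePull g.val 𝓘(ℝ, E) (f := fun q => ι (φ q))
        (fun q => L (φ q)) p u v :=
    congrArg ((1 / 2 : ℝ) * ·) (liePull_pullback g.val dφp dιp
      (alongDiffAt_of_contMDiff hι.continuous hL (φ p)) u v)
  have hl1 : liePull g.val 𝓘(ℝ, E) (f := fun q => ι (φ q)) X₁ p u v
      = D.γ.lie (fun q => D.P q (ϑ q)) p u v := by
    rw [show X₁ = _ from funext hX₁, ← hgf]
    refine liePull_mfderiv hf g.smooth (fun q => D.P q (ϑ q)) p
      ((D.contDiffAt_rep_P (hϑs p)).differentiableAt (by simp)) ?_ u v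
    rw [hgf]
    exact (D.hasFDerivAt_γ_rep p).differentiableAt
  have hl2 : liePull g.val 𝓘(ℝ, E) (f := fun q => ι (φ q)) X₂ p u v
      = D.γ.lie D.n p u v := by
    rw [show X₂ = _ from funext hX₂, ← hgf]
    refine liePull_mfderiv hf g.smooth D.n p (D.differentiableAt_rep_n p) ?_ u v
    rw [hgf]
    exact (D.hasFDerivAt_γ_rep p).differentiableAt
  have hnγ (b : TangentSpace 𝓘(ℝ, E) p) : D.γ p (D.n p) b = 0 := by
    have h := D.prod1 p b
    rwa [hD p, zero_mul, add_zero] at h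
  have hζ (b : TangentSpace 𝓘(ℝ, E) p) : g.val (ι (φ p))
      ((L (φ p) + (-1 : ℝ) • X₁ p) + μ p • X₂ p)
      (mfderiv 𝓘(ℝ, E) J (fun q => ι (φ q)) p b) = ϑ p (D.n p) * D.ell p b := by
    have h4 := D.prod4 p (ϑ p) b
    rw [map_add, map_add, map_smul, map_smul, add_apply, add_apply, smul_apply, smul_apply,
      hgL, hX₁, hX₂, hgf', hgf', hnγ, smul_zero, smul_eq_mul]
    linear_combination -h4
  have hc0 (w : E) : mvfderiv 𝓘(ℝ, E) (fun _ : N => (-1 : ℝ)) p w = 0 := by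
    rw [mvfderiv_const]
    rfl
  have hdz (w : E) : mvfderiv 𝓘(ℝ, E) (matchingZ D Dh φ) p w
      = - fderiv ℝ (D.evalN ϑ p) (extChartAt 𝓘(ℝ, E) p p) w / ϑ p (D.n p) ^ 2 := by
    rw [hz]
    exact D.mvfderiv_inv_apply_n (hϑs p) (hn p) w
  have hP := D.lie_γ_P (hϑs p) u v
  have hU := MetricHypersurfaceData.U_apply hD p u v
  rw [hY1, hY2, hξ, liePull_smul g.val dfp (dz p) (d2 p) u v,
    liePull_add g.val (d1 p) ((dX₂ p).smul (dμ p)) u v,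
    liePull_add g.val (dL p) ((dX₁ p).smul (dc p)) u v,
    liePull_smul g.val dfp (dc p) (dX₁ p) u v, liePull_smul g.val dfp (dμ p) (dX₂ p) u v,
    hl1, hl2]
  have hX₂' (b : E) : g.val (ι (φ p)) (X₂ p)
      (mfderiv 𝓘(ℝ, E) J (fun q => ι (φ q)) p b) = 0 := by
    rw [hX₂]
    exact (hgf' _ _).trans (hnγ _)
  have hζ' (b : E) : g.val (ι (φ p)) ((L (φ p) + (-1 : ℝ) • X₁ p) + μ p • X₂ p)
      (mfderiv 𝓘(ℝ, E) J (fun q => ι (φ q)) p b) = ϑ p (D.n p) * D.ell p b := hζ b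
  rw [hc0, hc0, g.symm _ _ (X₂ p), hX₂', hX₂', hζ', g.symm _ _ (_ + _ + _), hζ', hdz, hdz]
  have hμp : μ p = matchingZ D Dh φ p / 2 * matchingQ D Dh φ p := by
    rw [← hμ, hz]
    field_simp [hn p]
  have hz1 : matchingZ D Dh φ p = 1 / ϑ p (D.n p) := congrFun hz p
  have ht := hn p
  have hk (a b : ℝ) : -a / ϑ p (D.n p) ^ 2 * (ϑ p (D.n p) * b)
      = - (matchingZ D Dh φ p * a * b) := by
    rw [hz1]
    field_simp
  rw [hU, hμp, hk, hk]
  linear_combination (-matchingZ D Dh φ p) * hP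

end Jump

namespace MetricHypersurfaceData

variable {E : Type*} [NormedAddCommGroup E] [NormedSpace ℝ E] [FiniteDimensional ℝ E]
  {N : Type*} [TopologicalSpace N] [ChartedSpace E N] [IsManifold 𝓘(ℝ, E) ∞ N]
  {D : MetricHypersurfaceData 𝓘(ℝ, E) N} {p : N} {d : ℕ}
  {e : Fin d → TangentSpace 𝓘(ℝ, E) p} {ν : TangentSpace 𝓘(ℝ, E) p →L[ℝ] ℝ}
  {θ : Fin d → TangentSpace 𝓘(ℝ, E) p →L[ℝ] ℝ}

theorem IsNull.γ_n (hD : D.IsNull) (p : N) (v : TangentSpace 𝓘(ℝ, E) p) :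
    D.γ p (D.n p) v = 0 := by
  have h := D.prod1 p v
  rwa [hD p, zero_mul, add_zero] at h

namespace IsAdaptedBasis

theorem decomp (h : D.IsAdaptedBasis p e ν θ) (v : TangentSpace 𝓘(ℝ, E) p) :
    v = ν v • D.n p + ∑ A, θ A v • e A := by
  have hv : v ∈ Submodule.span ℝ
      (Set.range (Fin.cons (D.n p) e : Fin (d + 1) → TangentSpace 𝓘(ℝ, E) p)) := by
    rw [h.span]
    trivial
  induction hv using Submodule.span_induction with
  | mem x hx =>
    obtain ⟨i, rfl⟩ := hx
    refine Fin.cases ?_ (fun A => ?_) i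
    · simp [h.ν_n, h.θ_n]
    · simp [h.ν_e, h.θ_e]
  | zero => simp
  | add x y _ _ hx hy =>
    simp only [map_add, add_smul, Finset.sum_add_distrib]
    nth_rewrite 1 [hx, hy]
    abel
  | smul c x _ hx =>
    simp only [map_smul, smul_eq_mul, mul_smul, ← Finset.smul_sum, ← smul_add]
    rw [← hx]

theorem apply_decomp (h : D.IsAdaptedBasis p e ν θ) (α : TangentSpace 𝓘(ℝ, E) p →L[ℝ] ℝ)
    (v : TangentSpace 𝓘(ℝ, E) p) : α v = ν v * α (D.n p) + ∑ A, θ A v * α (e A) := by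
  conv_lhs => rw [h.decomp v]
  simp [map_sum]

theorem trace_eq (h : D.IsAdaptedBasis p e ν θ)
    (f : TangentSpace 𝓘(ℝ, E) p →ₗ[ℝ] TangentSpace 𝓘(ℝ, E) p) :
    LinearMap.trace ℝ (TangentSpace 𝓘(ℝ, E) p) f = ν (f (D.n p)) + ∑ A, θ A (f (e A)) := by
  have hf : f = (ν : TangentSpace 𝓘(ℝ, E) p →ₗ[ℝ] ℝ).smulRight (f (D.n p))
      + ∑ A, (θ A : TangentSpace 𝓘(ℝ, E) p →ₗ[ℝ] ℝ).smulRight (f (e A)) := by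
    refine LinearMap.ext fun v => ?_
    conv_lhs => rw [h.decomp v]
    simp [map_sum]
  conv_lhs => rw [hf]
  rw [map_add, map_sum]
  simp [LinearMap.trace_smulRight]

theorem P2_mul_hMatrix (hD : D.IsNull) (h : D.IsAdaptedBasis p e ν θ) :
    (Matrix.of fun A B => D.P2 p (θ A) (θ B)) * D.hMatrix p e = 1 := by
  ext A C
  have h1 := D.prod4 p (θ A) (e C)
  have h2 := h.apply_decomp (D.γ p (e C)) (D.P p (θ A))
  rw [D.γ_symm _ _ (D.n p), hD.γ_n, mul_zero, zero_add] at h2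
  rw [h.θ_n, zero_mul, add_zero, D.γ_symm, h2, h.θ_e] at h1
  rw [Matrix.mul_apply, Matrix.one_apply, ← h1]
  refine Finset.sum_congr rfl fun B _ => ?_
  rw [D.γ_symm p (e C)]
  rfl

theorem det_hMatrix_ne_zero (hD : D.IsNull) (h : D.IsAdaptedBasis p e ν θ) :
    (D.hMatrix p e).det ≠ 0 :=
  Matrix.det_ne_zero_of_left_inverse (h.P2_mul_hMatrix hD)

theorem inv_hMatrix (hD : D.IsNull) (h : D.IsAdaptedBasis p e ν θ) (A B : Fin d) :
    (D.hMatrix p e)⁻¹ A B = D.P2 p (θ A) (θ B) := by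
  rw [Matrix.inv_eq_left_inv (h.P2_mul_hMatrix hD)]
  rfl

theorem apply_P_θ (hD : D.IsNull) (h : D.IsAdaptedBasis p e ν θ)
    (α : TangentSpace 𝓘(ℝ, E) p →L[ℝ] ℝ) (A : Fin d) :
    α (D.P p (θ A)) = D.P2 p ν (θ A) * α (D.n p)
      + ∑ B, (D.hMatrix p e)⁻¹ A B * α (e B) := by
  rw [h.apply_decomp α, D.P_symm]
  simp only [h.inv_hMatrix hD]
  rfl

theorem trP_eq (hD : D.IsNull) (h : D.IsAdaptedBasis p e ν θ) {T : Cov2 𝓘(ℝ, E) N}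
    (hT : ∀ u v, T p u v = T p v u) :
    D.trP T p = ∑ A, ∑ B, (D.hMatrix p e)⁻¹ A B * T p (e A) (e B)
      + 2 * T p (D.n p) (D.P p ν) - D.P2 p ν ν * T p (D.n p) (D.n p) := by
  have h1 := h.apply_decomp (T p (D.n p)) (D.P p ν)
  rw [trP, h.trace_eq]
  have h2 : ν ((D.P p ∘ₗ (T p).toLinearMap) (D.n p)) = T p (D.n p) (D.P p ν) :=
    D.P_symm p _ _
  have h3 : ∀ A, θ A ((D.P p ∘ₗ (T p).toLinearMap) (e A))
      = D.P2 p ν (θ A) * T p (D.n p) (e A)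
        + ∑ B, (D.hMatrix p e)⁻¹ A B * T p (e A) (e B) := fun A => by
    rw [hT (D.n p)]
    exact (D.P_symm p _ _).trans (h.apply_P_θ hD (T p (e A)) A)
  rw [h2, Finset.sum_congr rfl fun A _ => h3 A, Finset.sum_add_distrib]
  change _ = D.P2 p ν ν * _ + ∑ A, D.P2 p ν (θ A) * _ at h1
  linear_combination -h1

variable {ε : ℝ}

theorem energyMomentum_ν_ν (hD : D.IsNull) (h : D.IsAdaptedBasis p e ν θ) {T : Cov2 𝓘(ℝ, E) N}
    (hT : ∀ u v, T p u v = T p v u) :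
    D.energyMomentum ε T p ν ν
      = - ε * ∑ A, ∑ B, (D.hMatrix p e)⁻¹ A B * T p (e A) (e B) := by
  rw [energyMomentum, h.trP_eq hD hT, hD p, h.ν_n, hT (D.P p ν)]
  ring

theorem energyMomentum_ν_θ (hD : D.IsNull) (h : D.IsAdaptedBasis p e ν θ) {T : Cov2 𝓘(ℝ, E) N}
    (hT : ∀ u v, T p u v = T p v u) (A : Fin d) :
    D.energyMomentum ε T p ν (θ A)
      = ε * ∑ B, (D.hMatrix p e)⁻¹ A B * T p (D.n p) (e B) := by
  have h1 := h.apply_P_θ hD (T p (D.n p)) A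
  rw [energyMomentum, hD p, h.ν_n, h.θ_n, hT (D.P p (θ A)), h1]
  ring

theorem energyMomentum_θ_θ (hD : D.IsNull) (h : D.IsAdaptedBasis p e ν θ) {T : Cov2 𝓘(ℝ, E) N}
    (A B : Fin d) :
    D.energyMomentum ε T p (θ A) (θ B)
      = - ε * (D.hMatrix p e)⁻¹ A B * T p (D.n p) (D.n p) := by
  rw [energyMomentum, hD p, h.θ_n, h.θ_n, h.inv_hMatrix hD]
  ring

theorem trace_hMatrix_eq_rhoBar (hD : D.IsNull) (h : D.IsAdaptedBasis p e ν θ)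
    {T : Cov2 𝓘(ℝ, E) N} (hT : ∀ u v, T p u v = T p v u) (hε : ε ^ 2 = 1) :
    ∑ A, ∑ B, (D.hMatrix p e)⁻¹ A B * T p (e A) (e B) = - ε * D.rhoBar ε T p ν := by
  have h1 : D.P2 p ν (D.γ p (D.energyFlux ε T p))
      = ε * (T p (D.n p) (D.P p ν) + D.ell2 p * T p (D.n p) (D.n p)) := by
    have h2 := D.prod4 p (T p (D.n p)) (D.P p ν)
    have h3 := D.prod3 p ν
    rw [h.ν_n, mul_one] at h3
    rw [P2, energyFlux, map_smul, map_sub, map_smul, smul_apply, sub_apply, smul_apply,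
      hD.γ_n, smul_zero, sub_zero, smul_eq_mul]
    linear_combination ε * h2 - ε * T p (D.n p) (D.n p) * h3
  have h2 := h.trP_eq hD hT
  rw [rhoBar, h1, energyDensity, pressure]
  linear_combination - ε ^ 2 * h2 - (∑ A, ∑ B, (D.hMatrix p e)⁻¹ A B * T p (e A) (e B)) * hε

theorem sum_inv_hMatrix_mul_γ (hD : D.IsNull) (h : D.IsAdaptedBasis p e ν θ) :
    ∑ A, ∑ B, (D.hMatrix p e)⁻¹ A B * D.γ p (e A) (e B) = d := by
  have h1 (A : Fin d) : ∑ B, (D.hMatrix p e)⁻¹ A B * D.γ p (e A) (e B) = 1 := by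
    have h2 := congrFun (congrFun (h.P2_mul_hMatrix hD) A) A
    rw [Matrix.mul_apply, Matrix.one_apply_eq] at h2
    refine Eq.trans (Finset.sum_congr rfl fun B _ => ?_) h2
    rw [h.inv_hMatrix hD, D.γ_symm]
    rfl
  simp [h1]

theorem gravPart_eq (hD : D.IsNull) (h : D.IsAdaptedBasis p e ν θ) {T : Cov2 𝓘(ℝ, E) N}
    (hT : ∀ u v, T p u v = T p v u) (hε : ε ^ 2 = 1) (hd : Module.finrank ℝ E = d + 1)
    (u v : TangentSpace 𝓘(ℝ, E) p) :
    D.gravPart ε T p ν u v = T p u v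
      - (∑ A, ∑ B, (D.hMatrix p e)⁻¹ A B * T p (e A) (e B)) / d * D.γ p u v := by
  rw [h.trace_hMatrix_eq_rhoBar hD hT hε, gravPart, hd]
  push_cast
  rw [add_sub_cancel_right]
  ring

theorem sum_gravPart (hD : D.IsNull) (h : D.IsAdaptedBasis p e ν θ) {T : Cov2 𝓘(ℝ, E) N}
    (hT : ∀ u v, T p u v = T p v u) (hε : ε ^ 2 = 1) (hd : Module.finrank ℝ E = d + 1) :
    ∑ A, ∑ B, (D.hMatrix p e)⁻¹ A B * D.gravPart ε T p ν (e A) (e B) = 0 := by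
  simp only [h.gravPart_eq hD hT hε hd]
  rcases Nat.eq_zero_or_pos d with rfl | hd0
  · simp
  have h1 := h.sum_inv_hMatrix_mul_γ hD
  set S := ∑ A, ∑ B, (D.hMatrix p e)⁻¹ A B * T p (e A) (e B) with hS
  have h2 : ∑ A, ∑ B, (D.hMatrix p e)⁻¹ A B * (T p (e A) (e B) - S / d * D.γ p (e A) (e B))
      = S - S / d * ∑ A, ∑ B, (D.hMatrix p e)⁻¹ A B * D.γ p (e A) (e B) := by
    rw [hS, Finset.mul_sum, ← hS, ← Finset.sum_sub_distrib]
    refine Finset.sum_congr rfl fun A _ => ?_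
    rw [Finset.mul_sum, ← Finset.sum_sub_distrib]
    exact Finset.sum_congr rfl fun B _ => by ring
  have h3 : (d : ℝ) ≠ 0 := by positivity
  rw [h2, h1]
  field_simp
  ring

theorem energyMomentum_eq_zero (hD : D.IsNull) (h : D.IsAdaptedBasis p e ν θ)
    {T : Cov2 𝓘(ℝ, E) N} {G : Fin d → Fin d → ℝ} (hG : ∀ A B, G A B = G B A)
    (hG0 : ∑ A, ∑ B, (D.hMatrix p e)⁻¹ A B * G A B = 0)
    (hT : T p = ∑ A, ∑ B, G A B • (θ A).smulRight (θ B))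
    (α β : TangentSpace 𝓘(ℝ, E) p →L[ℝ] ℝ) : D.energyMomentum ε T p α β = 0 := by
  have h1 (u v : TangentSpace 𝓘(ℝ, E) p) :
      T p u v = ∑ A, ∑ B, G A B * (θ A u * θ B v) := by
    rw [hT]
    simp
  have hn (u : TangentSpace 𝓘(ℝ, E) p) : T p u (D.n p) = 0 := by
    simp [h1, h.θ_n]
  have hs (u v : TangentSpace 𝓘(ℝ, E) p) : T p u v = T p v u := by
    rw [h1, h1, Finset.sum_comm]
    refine Finset.sum_congr rfl fun A _ => Finset.sum_congr rfl fun B _ => ?_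
    rw [hG A B]
    ring
  have he (A B : Fin d) : T p (e A) (e B) = G A B := by
    simp [h1, h.θ_e]
  have h2 := h.trP_eq hD hs
  simp only [he, hG0, hs (D.n p), hn] at h2
  rw [energyMomentum, h2, hD p, hn, hn, hn]
  ring

end IsAdaptedBasis

end MetricHypersurfaceData

namespace MetricHypersurfaceData

variable {E : Type*} [NormedAddCommGroup E] [NormedSpace ℝ E] [FiniteDimensional ℝ E]
  {N : Type*} [TopologicalSpace N] [ChartedSpace E N] [IsManifold 𝓘(ℝ, E) ∞ N]
  {D Dh : MetricHypersurfaceData 𝓘(ℝ, E) N} {θ : Cov1 𝓘(ℝ, E) N}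

theorem IsNull.U_n (hD : D.IsNull) (p : N) (v : TangentSpace 𝓘(ℝ, E) p) :
    D.U p (D.n p) v = 0 := by
  have := isManifold_one_of_infty (I := 𝓘(ℝ, E)) (M := N)
  have h1 := pderiv_γ_n hD p (D.n.rep p (extChartAt 𝓘(ℝ, E) p p)) v
  have h2 := γ_rep_n hD p (mem_extChartAt_target p)
    (fderiv ℝ (D.n.rep p) (extChartAt 𝓘(ℝ, E) p p) v)
  have h3 := Cov2.lie_apply D.γ D.n p (D.differentiableAt_rep_n p)
    (D.n.rep p (extChartAt 𝓘(ℝ, E) p p)) v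
  rw [h1, h2, add_zero, D.n.rep_self] at h3
  rw [U_apply hD]
  exact (congrArg ((1 / 2 : ℝ) * ·) h3).trans (mul_zero _)

theorem s_n (p : N) : D.s p (D.n p) = 0 := by
  change (1 / 2 : ℝ) * (D.ell.pderiv p (chartD 𝓘(ℝ, E) p p (D.n p))
    (chartD 𝓘(ℝ, E) p p (D.n p)) - D.ell.pderiv p (chartD 𝓘(ℝ, E) p p (D.n p))
    (chartD 𝓘(ℝ, E) p p (D.n p))) = 0
  rw [sub_self, mul_zero]

theorem lie_n_apply_n {p : N}
    (hθ : ContDiffAt ℝ ∞ (θ.rep p) (extChartAt 𝓘(ℝ, E) p p)) :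
    θ.lie D.n p (D.n p) = fderiv ℝ (D.evalN θ p) (extChartAt 𝓘(ℝ, E) p p) (D.n p) := by
  have := isManifold_one_of_infty (I := 𝓘(ℝ, E)) (M := N)
  have h1 := θ.lie_apply D.n p (D.differentiableAt_rep_n p)
    (D.n.rep p (extChartAt 𝓘(ℝ, E) p p))
  have h2 := D.fderiv_evalN hθ (D.n.rep p (extChartAt 𝓘(ℝ, E) p p))
  rw [D.n.rep_self] at h1 h2
  exact h1.trans h2.symm

/-- The matching conditions force `(φ^* ℓ̂)(n)` to be nowhere zero. -/
theorem matching_apply_n_ne_zero {φ : N ≃ₘ^∞⟮𝓘(ℝ, E), 𝓘(ℝ, E)⟯ N} {εp εm : ℝ}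
    (hD : D.IsNull) (h : MatchingConditions D Dh φ εp εm) (p : N) :
    Dh.ell.pullback 𝓘(ℝ, E) φ p (D.n p) ≠ 0 := by
  obtain ⟨z, V, -, -, -, hγ, hl, -, -⟩ := h
  intro h0
  have h1 := D.prod2 p
  rw [hD p, zero_mul, add_zero, ← hl, hγ] at h1
  change z p * (Dh.ell.pullback 𝓘(ℝ, E) φ p (D.n p) + D.γ p (V p) (D.n p)) = 1 at h1
  rw [h0, D.γ_symm, hD.γ_n] at h1
  simp at h1

theorem symNabla_n_eq (hD : D.IsNull) {p : N}
    (hθ : ContDiffAt ℝ ∞ (θ.rep p) (extChartAt 𝓘(ℝ, E) p p)) (h0 : θ p (D.n p) ≠ 0)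
    {z : N → ℝ} (hz : ∀ q, z q = 1 / θ q (D.n q)) (u : TangentSpace 𝓘(ℝ, E) p) :
    z p * D.symNabla θ p (D.n p) u = z p / 2 * θ.lie D.n p u
      - mvfderiv 𝓘(ℝ, E) z p u / (2 * z p) - D.s p u - z p * D.P2 p (θ p) (D.U p u) := by
  have h1 : mvfderiv 𝓘(ℝ, E) z p u
      = - fderiv ℝ (D.evalN θ p) (extChartAt 𝓘(ℝ, E) p p) u / θ p (D.n p) ^ 2 := by
    rw [show z = _ from funext hz]
    exact D.mvfderiv_inv_apply_n hθ h0 u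
  have h2 := symNabla_n hD hθ u
  rw [h1, h2, hz p]
  field_simp
  ring

theorem symNabla_n_n (hD : D.IsNull) {p : N}
    (hθ : ContDiffAt ℝ ∞ (θ.rep p) (extChartAt 𝓘(ℝ, E) p p)) (h0 : θ p (D.n p) ≠ 0)
    {z : N → ℝ} (hz : ∀ q, z q = 1 / θ q (D.n q)) :
    z p * D.symNabla θ p (D.n p) (D.n p) = - (mvfderiv 𝓘(ℝ, E) z p (D.n p) / z p) := by
  have h1 : mvfderiv 𝓘(ℝ, E) z p (D.n p)
      = - fderiv ℝ (D.evalN θ p) (extChartAt 𝓘(ℝ, E) p p) (D.n p) / θ p (D.n p) ^ 2 := by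
    rw [show z = _ from funext hz]
    exact D.mvfderiv_inv_apply_n hθ h0 (D.n p)
  have h2 : D.P2 p (θ p) (D.U p (D.n p)) = 0 := hD.U_n p _
  rw [symNabla_n_eq hD hθ h0 hz, h2, s_n, lie_n_apply_n hθ, h1, hz p]
  field_simp
  ring

end MetricHypersurfaceData

theorem transverseTensor_symm {E : Type*} [NormedAddCommGroup E] [NormedSpace ℝ E]
    {N : Type*} [TopologicalSpace N] [ChartedSpace E N]
    {E' : Type*} [NormedAddCommGroup E'] [NormedSpace ℝ E']
    {H' : Type*} [TopologicalSpace H'] {J : ModelWithCorners ℝ E' H'}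
    {M : Type*} [TopologicalSpace M] [ChartedSpace H' M] [IsManifold J ∞ M]
    {ι : N → M} (g : LorentzMetric J M) (L : ∀ p : N, TangentSpace J (ι p)) :
    (transverseTensor g 𝓘(ℝ, E) L).IsSymm := fun p u v =>
  congrArg ((1 / 2 : ℝ) * ·) (liePull_symm g.symm L p u v)

theorem Cov2.IsSymm.pullback {E : Type*} [NormedAddCommGroup E] [NormedSpace ℝ E]
    {N : Type*} [TopologicalSpace N] [ChartedSpace E N] {T : Cov2 𝓘(ℝ, E) N} (hT : T.IsSymm)
    (φ : N → N) : (T.pullback 𝓘(ℝ, E) φ).IsSymm := fun p _ _ =>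
  hT (φ p) _ _

namespace MetricHypersurfaceData

variable {E : Type*} [NormedAddCommGroup E] [NormedSpace ℝ E] [FiniteDimensional ℝ E]
  {N : Type*} [TopologicalSpace N] [ChartedSpace E N] [IsManifold 𝓘(ℝ, E) ∞ N]
  {D : MetricHypersurfaceData 𝓘(ℝ, E) N} {θ : Cov1 𝓘(ℝ, E) N}

theorem jump_n_apply (hD : D.IsNull) {p : N}
    (hθ : ContDiffAt ℝ ∞ (θ.rep p) (extChartAt 𝓘(ℝ, E) p p)) (h0 : θ p (D.n p) ≠ 0)
    {z : N → ℝ} (hz : ∀ q, z q = 1 / θ q (D.n q)) (u : TangentSpace 𝓘(ℝ, E) p) {J y y' q : ℝ}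
    (hJ : J = z p * (y + z p / 2 * q * D.U p (D.n p) u - D.symNabla θ p (D.n p) u) - y') :
    J = (z p * y - y') - z p / 2 * (θ.lie D.n) p u + mvfderiv 𝓘(ℝ, E) z p u / (2 * z p)
      + D.s p u + z p * D.P2 p (θ p) (D.U p u) := by
  have h1 := symNabla_n_eq hD hθ h0 hz u
  have h2 : D.U p (D.n p) u = 0 := hD.U_n p u
  rw [hJ, h2]
  linear_combination -h1

theorem jump_n_n (hD : D.IsNull) {p : N}
    (hθ : ContDiffAt ℝ ∞ (θ.rep p) (extChartAt 𝓘(ℝ, E) p p)) (h0 : θ p (D.n p) ≠ 0)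
    {z : N → ℝ} (hz : ∀ q, z q = 1 / θ q (D.n q)) {J y y' q : ℝ}
    (hJ : J = z p * (y + z p / 2 * q * D.U p (D.n p) (D.n p)
      - D.symNabla θ p (D.n p) (D.n p)) - y') :
    J = (z p * y - y') + mvfderiv 𝓘(ℝ, E) z p (D.n p) / z p := by
  have h1 := symNabla_n_n hD hθ h0 hz
  have h2 : D.U p (D.n p) (D.n p) = 0 := hD.U_n p _
  rw [hJ, h2]
  linear_combination -h1

end MetricHypersurfaceData

end NullShell

open NullShell in
theorem theorem4p4 {d : ℕ}
    {N : Type*} [TopologicalSpace N] [ChartedSpace (EuclideanSpace ℝ (Fin (d + 1))) N]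
    [IsManifold (𝓡 (d + 1)) ∞ N]
    {Mm : Type*} [TopologicalSpace Mm] [ChartedSpace (EuclideanHalfSpace (d + 2)) Mm]
    [IsManifold (𝓡∂ (d + 2)) ∞ Mm]
    {Mp : Type*} [TopologicalSpace Mp] [ChartedSpace (EuclideanHalfSpace (d + 2)) Mp]
    [IsManifold (𝓡∂ (d + 2)) ∞ Mp]
    -- the two spacetimes, and the embeddings onto their boundaries with their riggings
    (gm : LorentzMetric (𝓡∂ (d + 2)) Mm) (gp : LorentzMetric (𝓡∂ (d + 2)) Mp)
    (ιm : N → Mm) (ιp : N → Mp)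
    (Lm : ∀ p : N, TangentSpace (𝓡∂ (d + 2)) (ιm p))
    (Lp : ∀ p : N, TangentSpace (𝓡∂ (d + 2)) (ιp p))
    (hιm : Set.range ιm = (𝓡∂ (d + 2)).boundary Mm)
    (hιp : Set.range ιp = (𝓡∂ (d + 2)).boundary Mp)
    -- the two embedded null hypersurface data
    (D Dh : HypersurfaceData (𝓡 (d + 1)) N)
    (hD : D.IsEmbedded gm ιm Lm) (hDh : Dh.IsEmbedded gp ιp Lp)
    (hDnull : D.IsNull) (hDhnull : Dh.IsNull)
    (εm εp : ℝ) (hεm : IsOrientationSign Lm εm) (hεp : IsOrientationSign Lp εp)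
    -- the matching conditions
    (φ : N ≃ₘ^∞⟮𝓡 (d + 1), 𝓡 (d + 1)⟯ N)
    (hmatch : MatchingConditions D.toMetricHypersurfaceData Dh.toMetricHypersurfaceData φ εp εm)
    -- the transverse tensors and their jump
    (Ym Yhp Yp J : Cov2 (𝓡 (d + 1)) N)
    (hYm : Ym = transverseTensor gm (𝓡 (d + 1)) Lm)
    (hYhp : Yhp = transverseTensor gp (𝓡 (d + 1)) Lp)
    (hYp : Yp = (transverseTensor gp (𝓡 (d + 1)) (matchingRigging D.toMetricHypersurfaceData
      Dh.toMetricHypersurfaceData φ Lp)).pullback (𝓡 (d + 1)) φ)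
    (hJ : J = fun p => Yp p - Ym p)
    -- `ϑ = φ^* ℓ̂`, `z = 1 / ϑ(n)` and `Q = P(ϑ, ϑ) - φ^* ℓ̂⁽²⁾`
    (ϑ : Cov1 (𝓡 (d + 1)) N) (hϑ : ϑ = Dh.ell.pullback (𝓡 (d + 1)) φ)
    (z Q : N → ℝ) (hz : ∀ p, z p = 1 / ϑ p (D.n p))
    (hQ : ∀ p, Q p = D.P2 p (ϑ p) (ϑ p) - Dh.ell2 (φ p)) :
    -- `z` is a smooth nowhere vanishing function
    (∀ p, ϑ p (D.n p) ≠ 0) ∧ ContMDiff (𝓡 (d + 1)) 𝓘(ℝ, ℝ) ∞ z ∧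
    -- the jump
    (∀ p u v, J p u v = z p * (Yhp.pullback (𝓡 (d + 1)) φ p u v + z p / 2 * Q p * D.U p u v
      - D.symNabla ϑ p u v) - Ym p u v) ∧
    ∀ (p : N) (e : Fin d → TangentSpace (𝓡 (d + 1)) p)
      (ν : TangentSpace (𝓡 (d + 1)) p →L[ℝ] ℝ) (θ : Fin d → TangentSpace (𝓡 (d + 1)) p →L[ℝ] ℝ),
      D.IsAdaptedBasis p e ν θ →
      -- the components of the jump
      (∀ A B, J p (e A) (e B) =
        (z p * Yhp.pullback (𝓡 (d + 1)) φ p (e A) (e B) - Ym p (e A) (e B))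
          + z p ^ 2 / 2 * Q p * D.U p (e A) (e B) - z p * D.symNabla ϑ p (e A) (e B)) ∧
      (∀ A, J p (D.n p) (e A) =
        (z p * Yhp.pullback (𝓡 (d + 1)) φ p (D.n p) (e A) - Ym p (D.n p) (e A))
          - z p / 2 * (ϑ.lie D.n) p (e A) + mvfderiv (𝓡 (d + 1)) z p (e A) / (2 * z p)
          + D.s p (e A) + z p * D.P2 p (ϑ p) (D.U p (e A))) ∧
      (J p (D.n p) (D.n p) =
        (z p * Yhp.pullback (𝓡 (d + 1)) φ p (D.n p) (D.n p) - Ym p (D.n p) (D.n p))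
          + mvfderiv (𝓡 (d + 1)) z p (D.n p) / z p) ∧
      -- the energy-momentum tensor of the shell
      (D.hMatrix p e).det ≠ 0 ∧
      (D.energyMomentum εm J p ν ν =
        - εm * ∑ A, ∑ B, (D.hMatrix p e)⁻¹ A B * J p (e A) (e B)) ∧
      (∀ A, D.energyMomentum εm J p ν (θ A) =
        εm * ∑ B, (D.hMatrix p e)⁻¹ A B * J p (D.n p) (e B)) ∧
      (∀ A B, D.energyMomentum εm J p (θ A) (θ B) =
        - εm * (D.hMatrix p e)⁻¹ A B * J p (D.n p) (D.n p)) ∧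
      -- the purely gravitational part is the trace-free part of the components `[Y](e_A, e_B)`,
      -- and it does not contribute to the energy-momentum tensor
      (∑ A, ∑ B, (D.hMatrix p e)⁻¹ A B * J p (e A) (e B) = - εm * D.rhoBar εm J p ν) ∧
      (∀ A B, J p (e A) (e B) = D.gravPart εm J p ν (e A) (e B)
        + (∑ C, ∑ K, (D.hMatrix p e)⁻¹ C K * J p (e C) (e K)) / d * D.γ p (e A) (e B)) ∧
      (∑ A, ∑ B, (D.hMatrix p e)⁻¹ A B * D.gravPart εm J p ν (e A) (e B) = 0) ∧
      (∀ T : Cov2 (𝓡 (d + 1)) N,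
        (T p = ∑ A, ∑ B, D.gravPart εm J p ν (e A) (e B) • (θ A).smulRight (θ B)) →
        ∀ α β, D.energyMomentum εm T p α β = 0) := by
  have hιp' : ContMDiff (𝓡 (d + 1)) (𝓡∂ (d + 2)) ∞ ιp := hDh.embedding.contMDiff
  have hn : ∀ p, ϑ p (D.n p) ≠ 0 := by
    rw [hϑ]
    exact MetricHypersurfaceData.matching_apply_n_ne_zero hDnull hmatch
  have hϑs (p : N) : ContDiffAt ℝ ∞ (ϑ.rep p) (extChartAt (𝓡 (d + 1)) p p) := by
    rw [hϑ]
    exact Cov1.contDiffAt_rep_pullback φ.contMDiff Dh.ell_smooth p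
  have hzf : z = fun p => 1 / ϑ p (D.n p) := funext hz
  have hjump : ∀ p u v, J p u v = z p * (Yhp.pullback (𝓡 (d + 1)) φ p u v
      + z p / 2 * Q p * D.U p u v - D.symNabla ϑ p u v) - Ym p u v := by
    intro p u v
    obtain ⟨-, -, -, -, -, hγ, -⟩ := hmatch
    have h := transverseTensor_matchingRigging hιp' hDh.rigging.smooth hDh.γ_eq hDh.ell_eq
      hDnull hγ (by rwa [← hϑ]) p u v
    have hzp : matchingZ D.toMetricHypersurfaceData Dh.toMetricHypersurfaceData φ p = z p := by
      rw [hz, hϑ]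
      rfl
    have hQp : matchingQ D.toMetricHypersurfaceData Dh.toMetricHypersurfaceData φ p = Q p := by
      rw [hQ, hϑ]
      rfl
    rw [hzp, hQp, ← hYp, ← hYhp, ← hϑ] at h
    rw [hJ, ← h]
    rfl
  have hJs : ∀ p u v, J p u v = J p v u := by
    intro p u v
    have h1 : Yp p u v = Yp p v u := by
      have h0 : (transverseTensor gp (𝓡 (d + 1)) (matchingRigging
          D.toMetricHypersurfaceData Dh.toMetricHypersurfaceData φ Lp)).IsSymm :=
        transverseTensor_symm gp _
      have h := h0.pullback φ
      rw [← hYp] at h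
      exact h p u v
    have h2 : Ym p u v = Ym p v u := by
      have h : (transverseTensor gm (𝓡 (d + 1)) Lm).IsSymm := transverseTensor_symm gm Lm
      rw [← hYm] at h
      exact h p u v
    rw [hJ]
    exact congrArg₂ (· - ·) h1 h2
  have hε : εm ^ 2 = 1 := by
    rcases hεm with ⟨rfl, -⟩ | ⟨rfl, -⟩ <;> norm_num
  have hd : Module.finrank ℝ (EuclideanSpace ℝ (Fin (d + 1))) = d + 1 :=
    finrank_euclideanSpace_fin
  refine ⟨hn, ?_, hjump, ?_⟩
  · rw [hzf]
    exact fun p => D.contMDiffAt_inv_apply_n (hϑs p) (hn p)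
  intro p e ν θ hb
  have hgrav := hb.gravPart_eq hDnull (hJs p) hε hd
  have hgrav0 := hb.sum_gravPart hDnull (hJs p) hε hd
  refine ⟨fun A B => ?_, fun A => ?_, ?_, hb.det_hMatrix_ne_zero hDnull,
    hb.energyMomentum_ν_ν hDnull (hJs p), hb.energyMomentum_ν_θ hDnull (hJs p),
    hb.energyMomentum_θ_θ hDnull, hb.trace_hMatrix_eq_rhoBar hDnull (hJs p) hε,
    fun A B => ?_, hgrav0, fun T hT => ?_⟩
  · exact (hjump p (e A) (e B)).trans (by ring)
  · exact MetricHypersurfaceData.jump_n_apply hDnull (hϑs p) (hn p) hz (e A)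
      (hjump p (D.n p) (e A))
  · exact MetricHypersurfaceData.jump_n_n hDnull (hϑs p) (hn p) hz (hjump p (D.n p) (D.n p))
  · rw [hgrav]
    ring
  · refine hb.energyMomentum_eq_zero hDnull (fun A B => ?_) hgrav0 hT
    rw [hgrav, hgrav, hJs p (e A), D.γ_symm p (e A)]
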